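/- For $d\ge 1$ let $A$ be the random symmetric $d\times d$ matrix whose diagonal entries are $0$ and whose entries above the diagonal are independent $\mathcal N(0,1/d^2)$ random variables (standard deviation $1/d$). Write $\|\cdot\|_2$ and $\|\cdot\|_F$ for the spectral and the Frobenius norm, and for real constants $C_1,C_2$ let $\mathcal E_d(C_1,C_2)$ be the event that $\|A\|_2\le C_1/\sqrt d$ and $\|A\|_F\le C_2$. For a symmetric matrix $A$ put $$\mathbf D_A=\tfrac{9}{10}\,\mathcal N(0,I+A)+\tfrac1{10}\,\mathcal N(0,I-9A),$$ a distribution on $\mathbb R^d$ whenever $I+A$ and $I-9A$ are positive semidefinite (on $\mathcal E_d(C_1,C_2)$ this is the case for all large $d$). Let $\mathcal D^N=\mathcal D^N_{d,C_1,C_2}$ be the distribution on $(\mathbb R^d)^N$ obtained by drawing $A$ from its law conditioned on $\mathcal E_d(C_1,C_2)$ and then taking $N$ i.i.d. samples from $\mathbf D_A$. Let $G=\mathcal N(0,I)$ on $\mathbb R^d$, let $G^N$ be the law of $N$ i.i.d. samples from $G$, and let $\chi^2_P(Q,R)=\int \frac{dQ\,dR}{dP}$. **Proposition.** (i) For all sufficiently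 large constants $C_1,C_2$, $\Pr[\mathcal E_d(C_1,C_2)]\to1$ as $d\to\infty$. (ii) Let $C_1,C_2$ be any constants with $\Pr[\mathcal E_d(C_1,C_2)]\to 1$ as $d\to\infty$. For every sequence $N=N(d)$ of non-negative integers with $N=o(d^2)$, $$\chi^2_{G^N}(\mathcal D^N,\mathcal D^N)=1+o(1)\qquad (d\to\infty).$$ -/

import Mathlib

open MeasureTheory ProbabilityTheory Filter Topology Asymptotics
open scoped ENNReal NNReal

noncomputable section

namespace RobustCov

/-- The chi-squared inner product `χ²_A(B, C) = ∫ dB dC / dA`, as an extended non-negative real,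
computed with densities with respect to the dominating measure `A + B + C`
(with `0 / 0 = 0` and `t / 0 = ∞` for `t > 0`). -/
def chiSq {α : Type*} [MeasurableSpace α] (A B C : Measure α) : ℝ≥0∞ :=
  ∫⁻ x, B.rnDeriv (A + B + C) x * C.rnDeriv (A + B + C) x / A.rnDeriv (A + B + C) x ∂(A + B + C)

/-- If `B` and `C` are absolutely continuous with respect to `A`, then
`χ²_A(B, C) = ∫ (dB/dA) (dC/dA) dA`. -/
theorem chiSq_eq_of_ac {α : Type*} [MeasurableSpace α] (A B C : Measure α)
    [SigmaFinite A] [SigmaFinite B] [SigmaFinite C] (hB : B ≪ A) (hC : C ≪ A) :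
    chiSq A B C = ∫⁻ x, B.rnDeriv A x * C.rnDeriv A x ∂A := by
  have hA : A ≪ A + B + C := by
    rw [add_assoc]; exact Measure.le_add_right le_rfl |>.absolutelyContinuous
  have h1 := Measure.rnDeriv_mul_rnDeriv (κ := A + B + C) hB
  have h2 := Measure.rnDeriv_mul_rnDeriv (κ := A + B + C) hC
  have h3 := Measure.rnDeriv_lt_top A (A + B + C)
  have h4 : ∫⁻ x, B.rnDeriv A x * C.rnDeriv A x ∂A =
      ∫⁻ x, A.rnDeriv (A + B + C) x * (B.rnDeriv A x * C.rnDeriv A x) ∂(A + B + C) :=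
    (lintegral_rnDeriv_mul hA (by fun_prop)).symm
  rw [h4, chiSq]
  refine lintegral_congr_ae ?_
  filter_upwards [h1, h2, h3] with x h1 h2 h3
  simp only [Pi.mul_apply] at h1 h2
  rw [← h1, ← h2]
  by_cases h0 : A.rnDeriv (A + B + C) x = 0
  · simp [h0]
  · rw [mul_mul_mul_comm, ← mul_assoc, mul_div_assoc, ENNReal.div_self h0 h3.ne, mul_one,
      mul_comm]

/-- The symmetric `d × d` matrix with zero diagonal and with entries `g` above the diagonal. -/
def symMatrix {d : ℕ} (g : {p : Fin d × Fin d // p.1 < p.2} → ℝ) : Matrix (Fin d) (Fin d) ℝ :=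
  Matrix.of fun i j =>
    if h : i < j then g ⟨(i, j), h⟩ else if h : j < i then g ⟨(j, i), h⟩ else 0

/-- The joint law of the entries above the diagonal: independent centred Gaussians with
standard deviation `1 / d`, i.e. variance `1 / d ^ 2`. -/
def entryLaw (d : ℕ) : Measure ({p : Fin d × Fin d // p.1 < p.2} → ℝ) :=
  Measure.pi fun _ => gaussianReal 0 (1 / (d : ℝ≥0) ^ 2)

/-- The spectral norm of a real square matrix: the operator norm of the map it induces on
Euclidean space. -/
def matSpectralNorm {d : ℕ} (A : Matrix (Fin d) (Fin d) ℝ) : ℝ :=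
  ‖Matrix.toEuclideanCLM (n := Fin d) (𝕜 := ℝ) A‖

/-- The Frobenius norm of a real square matrix. -/
def frobeniusNorm {d : ℕ} (A : Matrix (Fin d) (Fin d) ℝ) : ℝ :=
  √(∑ i, ∑ j, A i j ^ 2)

/-- The event that the random matrix `A` satisfies `‖A‖₂ ≤ C₁ / √d` and `‖A‖_F ≤ C₂`. -/
def normEvent (d : ℕ) (C₁ C₂ : ℝ) : Set ({p : Fin d × Fin d // p.1 < p.2} → ℝ) :=
  {g | matSpectralNorm (symMatrix g) ≤ C₁ / √(d : ℝ) ∧ frobeniusNorm (symMatrix g) ≤ C₂}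

/-- The noisy Gaussian `(9/10) N(0, I + A) + (1/10) N(0, I - 9 A)` on `ℝ^d`. -/
def noisyGaussian {d : ℕ} (A : Matrix (Fin d) (Fin d) ℝ) : Measure (EuclideanSpace ℝ (Fin d)) :=
  (9 / 10 : ℝ≥0∞) • multivariateGaussian 0 (1 + A) +
    (1 / 10 : ℝ≥0∞) • multivariateGaussian 0 (1 - (9 : ℝ) • A)

/-- The law of `N` i.i.d. samples from a distribution `P`. -/
def iidSamples {E : Type*} [MeasurableSpace E] (N : ℕ) (P : Measure E) : Measure (Fin N → E) :=
  Measure.pi fun _ => P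

/-- The standard Gaussian distribution `G = N(0, I)` on `ℝ^d`. -/
def stdG (d : ℕ) : Measure (EuclideanSpace ℝ (Fin d)) := multivariateGaussian 0 1

/-- The distribution `𝒟^N`: pick the random matrix `A` from its Gaussian law conditioned on
`‖A‖₂ ≤ C₁ / √d` and `‖A‖_F ≤ C₂`, and return `N` i.i.d. samples from the noisy Gaussian of `A`. -/
def ensembleSamples (d : ℕ) (C₁ C₂ : ℝ) (N : ℕ) :
    Measure (Fin N → EuclideanSpace ℝ (Fin d)) :=
  (ProbabilityTheory.cond (entryLaw d) (normEvent d C₁ C₂)).bind fun g =>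
    iidSamples N (noisyGaussian (symMatrix g))

end RobustCov

end

/-!
By Fubini, the chi-squared inner product of a mixture of product measures with itself is
`𝔼 K(A, B) ^ N`, where `A`, `B` are independent copies of the mixing parameter and
`K(A, B) = χ²_G(D_A, D_B)`. For Gaussian scale mixtures `D_A = ∑ₖ wₖ N(0, I + sₖ A)`,
`K(A, B) = ∑ₖₗ wₖ wₗ det(I - sₖ sₗ A B) ^ (-1/2)`. Expanding `log det`, the term linear in `A B`
is averaged out because `∑ₖ wₖ sₖ = 0`, so on the event of small spectral norms
`K(A, B) ≤ exp(L tr(AB)² + c tr((AB)²) + L / d²)`. For fixed `B` of bounded Frobenius norm, the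
first two terms form a quadratic form in the Gaussian entries of `A`, whose matrix, at the scale
`1 / d²` of the variances, has bounded trace and Hilbert–Schmidt norm. After multiplication by `N`
it is therefore still of order `N / d² = o(1)`, and its exponential moment tends to `1`.

For the spectral norm of `A`, the function `v ↦ exp(t |⟪v, A v⟫|)` is at least `exp(15 t ‖A‖ / 64)`
on some ball of radius `1/8` inside the ball of radius `9/8`. Averaging over the latter costs only a
factor `9 ^ d` and plays the part of a union bound over a net. The Frobenius norm is again the
exponential moment of a Gaussian quadratic form.
-/

noncomputable section

namespace RobustCov

open Matrix
open scoped Matrix.Norms.L2Operator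

section ProductMeasures

lemma lintegral_fin_prod_eq_prod {n : ℕ} {E : Fin n → Type*} [∀ i, MeasurableSpace (E i)]
    {μ : (i : Fin n) → Measure (E i)} [∀ i, SigmaFinite (μ i)] {f : (i : Fin n) → E i → ℝ≥0∞}
    (hf : ∀ i, Measurable (f i)) :
    ∫⁻ x, ∏ i, f i (x i) ∂(Measure.pi μ) = ∏ i, ∫⁻ x, f i x ∂(μ i) := by
  induction n with
  | zero => simp
  | succ n ih =>
    have htail : Measurable fun x : (i : Fin n) → E i.succ => ∏ i, f i.succ (x i) := by
      have := fun i : Fin n => hf i.succ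
      fun_prop
    calc ∫⁻ x, ∏ i, f i (x i) ∂(Measure.pi μ)
        = ∫⁻ x : E 0 × ((i : Fin n) → E i.succ), f 0 x.1 * ∏ i : Fin n, f i.succ (x.2 i)
            ∂((μ 0).prod (Measure.pi fun i => μ i.succ)) := by
          refine (((measurePreserving_piFinSuccAbove μ 0).symm).lintegral_comp_emb
            (MeasurableEquiv.measurableEmbedding _) _).symm.trans (lintegral_congr fun x => ?_)
          rw [Fin.prod_univ_succ]
          rfl
      _ = (∫⁻ x, f 0 x ∂μ 0) * ∏ i : Fin n, ∫⁻ x, f i.succ x ∂(μ i.succ) := by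
          rw [← ih fun i => hf i.succ, ← lintegral_prod_mul (hf 0).aemeasurable htail.aemeasurable]
      _ = ∏ i, ∫⁻ x, f i x ∂(μ i) := by rw [Fin.prod_univ_succ]

variable {ι : Type*} [Fintype ι] {E : ι → Type*} [∀ i, MeasurableSpace (E i)]
  {μ : (i : ι) → Measure (E i)} [∀ i, SigmaFinite (μ i)] {f : (i : ι) → E i → ℝ≥0∞}

lemma lintegral_fintype_prod_eq_prod (hf : ∀ i, Measurable (f i)) :
    ∫⁻ x, ∏ i, f i (x i) ∂(Measure.pi μ) = ∏ i, ∫⁻ x, f i x ∂(μ i) := by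
  let e := (Fintype.equivFin ι).symm
  rw [← (measurePreserving_piCongrLeft _ e).lintegral_comp_emb
    (MeasurableEquiv.measurableEmbedding _)]
  simp_rw [← e.prod_comp, MeasurableEquiv.coe_piCongrLeft, Equiv.piCongrLeft_apply_apply]
  exact lintegral_fin_prod_eq_prod fun i => hf _

lemma pi_withDensity (hf : ∀ i, Measurable (f i))
    [∀ i, SigmaFinite ((μ i).withDensity (f i))] :
    Measure.pi (fun i => (μ i).withDensity (f i)) =
      (Measure.pi μ).withDensity fun x => ∏ i, f i (x i) := by
  refine Measure.pi_eq fun s hs => ?_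
  have indicator_prod (x : (i : ι) → E i) :
      (Set.univ.pi s).indicator (fun x => ∏ i, f i (x i)) x =
        ∏ i, (s i).indicator (f i) (x i) := by
    by_cases hx : x ∈ Set.univ.pi s
    · rw [Set.indicator_of_mem hx]
      exact Finset.prod_congr rfl fun i _ => (Set.indicator_of_mem (hx i trivial) _).symm
    · rw [Set.indicator_of_notMem hx]
      simp only [Set.mem_pi, Set.mem_univ, true_imp_iff, not_forall] at hx
      obtain ⟨i, hi⟩ := hx
      exact (Finset.prod_eq_zero (Finset.mem_univ i) (Set.indicator_of_notMem hi _)).symm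
  rw [withDensity_apply _ (MeasurableSet.univ_pi hs),
    ← lintegral_indicator (MeasurableSet.univ_pi hs), lintegral_congr indicator_prod,
    lintegral_fintype_prod_eq_prod fun i => (hf i).indicator (hs i)]
  refine Finset.prod_congr rfl fun i _ => ?_
  rw [lintegral_indicator (hs i), withDensity_apply _ (hs i)]

lemma map_withDensity_comp {α β : Type*} [MeasurableSpace α] [MeasurableSpace β]
    {μ : Measure α} {ν : Measure β} {T : α → β} (hT : MeasurePreserving T μ ν) {f : β → ℝ≥0∞}
    (hf : Measurable f) : (μ.withDensity (f ∘ T)).map T = ν.withDensity f := by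
  ext s hs
  rw [Measure.map_apply hT.measurable hs, withDensity_apply _ (hT.measurable hs),
    withDensity_apply _ hs, ← hT.setLIntegral_comp_preimage hs hf]
  rfl

end ProductMeasures

section GaussianDensity

variable {ι : Type*} [Fintype ι]

/-- The density of the standard Gaussian with respect to Lebesgue measure. -/
def stdGaussianPDF (x : EuclideanSpace ℝ ι) : ℝ≥0∞ :=
  ENNReal.ofReal ((√(2 * Real.pi))⁻¹ ^ Fintype.card ι * Real.exp (-(x ⬝ᵥ x) / 2))

lemma measurable_stdGaussianPDF : Measurable (stdGaussianPDF (ι := ι)) := by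
  unfold stdGaussianPDF
  fun_prop

lemma stdGaussian_eq_withDensity_volume :
    stdGaussian (EuclideanSpace ℝ ι) = volume.withDensity stdGaussianPDF := by
  have : SigmaFinite ((volume : Measure ℝ).withDensity (gaussianPDF 0 1)) := by
    rw [← gaussianReal_of_var_ne_zero _ one_ne_zero]
    infer_instance
  rw [← map_pi_eq_stdGaussian, gaussianReal_of_var_ne_zero _ one_ne_zero,
    pi_withDensity fun _ => measurable_gaussianPDF 0 1,
    ← map_withDensity_comp (PiLp.volume_preserving_toLp ι) measurable_stdGaussianPDF]
  congr 2
  ext x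
  simp only [Function.comp, stdGaussianPDF, gaussianPDF, gaussianPDFReal]
  rw [← ENNReal.ofReal_prod_of_nonneg (fun _ _ => by positivity), Finset.prod_mul_distrib,
    ← Real.exp_sum]
  simp [dotProduct, Finset.sum_neg_distrib, Finset.sum_div, pow_two, neg_div]

variable [DecidableEq ι]

lemma measurePreserving_toEuclideanCLM {R : Matrix ι ι ℝ} (hR : R.det ≠ 0) :
    MeasurePreserving (toEuclideanCLM (𝕜 := ℝ) R) volume
      (ENNReal.ofReal |R.det⁻¹| • (volume : Measure (EuclideanSpace ℝ ι))) := by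
  have hdet : LinearMap.det (toEuclideanCLM (𝕜 := ℝ) R : EuclideanSpace ℝ ι →ₗ[ℝ] _) = R.det := by
    rw [coe_toEuclideanCLM_eq_toEuclideanLin]
    exact LinearMap.det_toLpLin 2 R
  refine ⟨(toEuclideanCLM (𝕜 := ℝ) R).continuous.measurable, ?_⟩
  rw [← hdet]
  exact Measure.map_linearMap_addHaar_eq_smul_addHaar volume (hdet ▸ hR)

lemma map_toEuclideanCLM_withDensity_volume {R : Matrix ι ι ℝ} (hR : R.det ≠ 0)
    {f : EuclideanSpace ℝ ι → ℝ≥0∞} (hf : Measurable f) :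
    (volume.withDensity f).map (toEuclideanCLM (𝕜 := ℝ) R) =
      volume.withDensity fun x => ENNReal.ofReal |R.det⁻¹| * f (toEuclideanCLM (𝕜 := ℝ) R⁻¹ x) := by
  have hcomp : f = (f ∘ toEuclideanCLM (𝕜 := ℝ) R⁻¹) ∘ toEuclideanCLM (𝕜 := ℝ) R := by
    ext x
    simp only [Function.comp]
    rw [← mul_apply_eq_comp, ← map_mul, nonsing_inv_mul _ hR.isUnit, map_one]
    rfl
  have hmeas : Measurable (f ∘ toEuclideanCLM (𝕜 := ℝ) R⁻¹) :=
    hf.comp (ContinuousLinearMap.continuous _).measurable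
  conv_lhs => rw [hcomp]
  rw [map_withDensity_comp (measurePreserving_toEuclideanCLM hR) hmeas, withDensity_smul_measure,
    ← withDensity_smul _ hmeas]
  rfl

/-- The density of `N(0, S)` with respect to the standard Gaussian. -/
def gaussianTilt (S : Matrix ι ι ℝ) (x : EuclideanSpace ℝ ι) : ℝ≥0∞ :=
  ENNReal.ofReal ((√S.det)⁻¹ * Real.exp (-(x ⬝ᵥ (S⁻¹ - 1) *ᵥ x) / 2))

section Measurability

variable {Γ : Type*} [MeasurableSpace Γ] {S : Γ → Matrix ι ι ℝ}

lemma measurable_det (hS : ∀ i j, Measurable fun γ => S γ i j) :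
    Measurable fun γ => (S γ).det := by
  simp only [det_apply]
  fun_prop

lemma measurable_inv_apply (hS : ∀ i j, Measurable fun γ => S γ i j) (i j : ι) :
    Measurable fun γ => (S γ)⁻¹ i j := by
  simp only [inv_def, Matrix.smul_apply, Ring.inverse_eq_inv, smul_eq_mul, adjugate_apply]
  refine (measurable_det hS).inv.mul (measurable_det fun k l => ?_)
  simp only [updateRow_apply]
  split_ifs <;> fun_prop

lemma measurable_gaussianTilt_comp (hS : ∀ i j, Measurable fun γ => S γ i j) :
    Measurable fun p : Γ × EuclideanSpace ℝ ι => gaussianTilt (S p.1) p.2 := by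
  have hdet : Measurable fun p : Γ × EuclideanSpace ℝ ι => (S p.1).det :=
    (measurable_det hS).comp measurable_fst
  have hinv (i j : ι) : Measurable fun p : Γ × EuclideanSpace ℝ ι => (S p.1)⁻¹ i j :=
    (measurable_inv_apply hS i j).comp measurable_fst
  have hcoord (i : ι) : Measurable fun p : Γ × EuclideanSpace ℝ ι => p.2 i := by fun_prop
  refine ENNReal.measurable_ofReal.comp (hdet.sqrt.inv.mul (Real.measurable_exp.comp
    (Measurable.div_const (Measurable.neg ?_) _)))
  exact Finset.measurable_sum _ fun i _ => (hcoord i).mul <|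
    Finset.measurable_sum _ fun j _ => ((hinv i j).sub_const _).mul (hcoord j)

end Measurability

lemma measurable_gaussianTilt (S : Matrix ι ι ℝ) : Measurable (gaussianTilt S) := by
  unfold gaussianTilt
  fun_prop

lemma dotProduct_inv_mulVec_self {R : Matrix ι ι ℝ} (hR : Rᵀ = R) (x : ι → ℝ) :
    (R⁻¹ *ᵥ x) ⬝ᵥ (R⁻¹ *ᵥ x) = x ⬝ᵥ (R * R)⁻¹ *ᵥ x := by
  rw [dotProduct_mulVec, vecMul_mulVec, Matrix.mul_inv_rev, transpose_nonsing_inv, hR,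
    ← dotProduct_mulVec]

open scoped MatrixOrder in
lemma multivariateGaussian_zero_eq_withDensity {S : Matrix ι ι ℝ} (hS : S.PosDef) :
    multivariateGaussian 0 S =
      (stdGaussian (EuclideanSpace ℝ ι)).withDensity (gaussianTilt S) := by
  let R := CFC.sqrt S
  have hRR : R * R = S := CFC.sqrt_mul_sqrt_self S hS.posSemidef.nonneg
  have hRpos : R.PosSemidef := nonneg_iff_posSemidef.1 (CFC.sqrt_nonneg S)
  have hRt : Rᵀ = R := hRpos.isHermitian
  have hdet : R.det * R.det = S.det := by rw [← det_mul, hRR]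
  have hRdet : 0 < R.det := hRpos.det_nonneg.lt_of_ne' fun h => by
    simp [h, hS.det_pos.ne] at hdet
  have hsqrt : √S.det = R.det := by rw [← hdet, Real.sqrt_mul_self hRdet.le]
  have density_eq (x : EuclideanSpace ℝ ι) :
      ENNReal.ofReal |R.det⁻¹| * stdGaussianPDF (toEuclideanCLM (𝕜 := ℝ) R⁻¹ x) =
        stdGaussianPDF x * gaussianTilt S x := by
    have hquad : (R⁻¹ *ᵥ x.ofLp) ⬝ᵥ (R⁻¹ *ᵥ x.ofLp) =
        x.ofLp ⬝ᵥ x.ofLp + x.ofLp ⬝ᵥ (S⁻¹ - 1) *ᵥ x.ofLp := by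
      rw [dotProduct_inv_mulVec_self hRt, hRR, sub_mulVec, one_mulVec,
        dotProduct_sub, add_sub_cancel]
    simp only [stdGaussianPDF, gaussianTilt, ofLp_toEuclideanCLM]
    rw [← ENNReal.ofReal_mul (by positivity), ← ENNReal.ofReal_mul (by positivity), hquad, hsqrt,
      abs_of_pos (inv_pos.2 hRdet), neg_add, add_div, Real.exp_add]
    congr 1
    ring
  calc multivariateGaussian 0 S
      = (volume.withDensity stdGaussianPDF).map (toEuclideanCLM (𝕜 := ℝ) R) := by
        simp only [multivariateGaussian, stdGaussian_eq_withDensity_volume, zero_add]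
        rfl
    _ = volume.withDensity fun x => stdGaussianPDF x * gaussianTilt S x := by
        rw [map_toEuclideanCLM_withDensity_volume hRdet.ne' measurable_stdGaussianPDF]
        exact congrArg _ (funext density_eq)
    _ = (stdGaussian (EuclideanSpace ℝ ι)).withDensity (gaussianTilt S) := by
        rw [stdGaussian_eq_withDensity_volume]
        exact withDensity_mul _ measurable_stdGaussianPDF (measurable_gaussianTilt S)

end GaussianDensity

section GaussianIntegrals

variable {ι : Type*} [Fintype ι] [DecidableEq ι]

lemma dotProduct_mulVec_le_l2_opNorm (M : Matrix ι ι ℝ) (x : ι → ℝ) :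
    x ⬝ᵥ M *ᵥ x ≤ ‖M‖ * (x ⬝ᵥ x) := by
  let v : EuclideanSpace ℝ ι := WithLp.toLp 2 x
  have hx : x ⬝ᵥ x = ‖v‖ ^ 2 := by
    rw [EuclideanSpace.real_norm_sq_eq]
    simp [v, dotProduct, pow_two]
  calc x ⬝ᵥ M *ᵥ x = inner ℝ v (toEuclideanCLM (𝕜 := ℝ) M v) := (inner_toEuclideanCLM M v v).symm
    _ ≤ ‖v‖ * ‖toEuclideanCLM (𝕜 := ℝ) M v‖ := real_inner_le_norm _ _
    _ ≤ ‖v‖ * (‖M‖ * ‖v‖) := by gcongr; exact (toEuclideanCLM (𝕜 := ℝ) M).le_opNorm v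
    _ = ‖M‖ * (x ⬝ᵥ x) := by rw [hx]; ring

lemma posDef_one_sub_of_l2_opNorm_lt_one {M : Matrix ι ι ℝ} (hM : M.IsHermitian)
    (h : ‖M‖ < 1) : (1 - M).PosDef := by
  refine PosDef.of_dotProduct_mulVec_pos (isHermitian_one.sub hM) fun x hx => ?_
  have hpos : 0 < x ⬝ᵥ x := by simpa using dotProduct_star_self_pos_iff.2 hx
  simp only [star_trivial, sub_mulVec, one_mulVec, dotProduct_sub]
  nlinarith [dotProduct_mulVec_le_l2_opNorm M x]

lemma posDef_one_add_of_l2_opNorm_lt_one {M : Matrix ι ι ℝ} (hM : M.IsHermitian)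
    (h : ‖M‖ < 1) : (1 + M).PosDef := by
  rw [← sub_neg_eq_add]
  exact posDef_one_sub_of_l2_opNorm_lt_one hM.neg (by rwa [norm_neg])

lemma posDef_inv_one_add_sub_half {A : Matrix ι ι ℝ} (hA : A.IsHermitian) (h : ‖A‖ < 1) :
    ((1 + A)⁻¹ - (1 / 2 : ℝ) • (1 : Matrix ι ι ℝ)).PosDef := by
  have hpos := posDef_one_add_of_l2_opNorm_lt_one hA h
  have hunit : IsUnit (1 + A).det := hpos.det_pos.ne'.isUnit
  have hAA : (A * A).IsHermitian := by rw [IsHermitian, conjTranspose_mul, hA.eq]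
  have hnorm : ‖A * A‖ < 1 := (norm_mul_le _ _).trans_lt (by nlinarith [norm_nonneg A])
  have hhalf : ((1 / 2 : ℝ) • (1 - A * A)).PosDef :=
    (posDef_one_sub_of_l2_opNorm_lt_one hAA hnorm).smul (by norm_num)
  have hfactor : (1 / 2 : ℝ) • (1 - A * A) =
      (1 + A) - (1 / 2 : ℝ) • ((1 + A) * (1 + A)) := by
    simp only [mul_add, add_mul, mul_one, one_mul]
    module
  have hinj : Function.Injective ((1 + A)⁻¹).mulVec :=
    mulVec_injective_of_isUnit (isUnit_nonsing_inv_iff.2 hpos.isUnit)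
  convert hhalf.conjTranspose_mul_mul_same hinj using 1
  rw [hpos.inv.isHermitian.eq, hfactor, mul_sub, sub_mul, nonsing_inv_mul _ hunit, one_mul,
    mul_smul_comm, smul_mul_assoc, ← mul_assoc, nonsing_inv_mul _ hunit, one_mul,
    mul_nonsing_inv _ hunit]

lemma lintegral_exp_quadraticForm_stdGaussian {K : Matrix ι ι ℝ} (hK : (1 - K).PosDef) :
    ∫⁻ x, ENNReal.ofReal (Real.exp ((x.ofLp ⬝ᵥ K *ᵥ x.ofLp) / 2))
      ∂(stdGaussian (EuclideanSpace ℝ ι)) = ENNReal.ofReal (√(1 - K).det)⁻¹ := by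
  have hdet := hK.det_pos
  have htilt (x : EuclideanSpace ℝ ι) : gaussianTilt (1 - K)⁻¹ x =
      ENNReal.ofReal √(1 - K).det *
        ENNReal.ofReal (Real.exp ((x.ofLp ⬝ᵥ K *ᵥ x.ofLp) / 2)) := by
    rw [gaussianTilt, nonsing_inv_nonsing_inv _ hdet.ne'.isUnit, det_nonsing_inv,
      Ring.inverse_eq_inv, Real.sqrt_inv, inv_inv, sub_sub_cancel_left, neg_mulVec,
      dotProduct_neg, neg_neg, ENNReal.ofReal_mul (Real.sqrt_nonneg _)]
  have hmass : multivariateGaussian 0 (1 - K)⁻¹ Set.univ = 1 := measure_univ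
  rw [multivariateGaussian_zero_eq_withDensity hK.inv, withDensity_apply _ MeasurableSet.univ,
    setLIntegral_univ, lintegral_congr htilt, lintegral_const_mul' _ _ ENNReal.ofReal_ne_top,
    mul_comm] at hmass
  rw [ENNReal.eq_inv_of_mul_eq_one_left hmass, ENNReal.ofReal_inv_of_pos (Real.sqrt_pos.2 hdet)]

lemma gaussianTilt_mul_gaussianTilt (S T : Matrix ι ι ℝ) (x : EuclideanSpace ℝ ι) :
    gaussianTilt S x * gaussianTilt T x =
      ENNReal.ofReal ((√S.det)⁻¹ * (√T.det)⁻¹) *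
        ENNReal.ofReal (Real.exp ((x.ofLp ⬝ᵥ (1 + 1 - S⁻¹ - T⁻¹) *ᵥ x.ofLp) / 2)) := by
  rw [gaussianTilt, gaussianTilt, ← ENNReal.ofReal_mul (by positivity),
    ← ENNReal.ofReal_mul (by positivity), mul_mul_mul_comm, ← Real.exp_add]
  congr 3
  simp only [sub_mulVec, add_mulVec, dotProduct_sub, dotProduct_add]
  ring

lemma lintegral_gaussianTilt_mul_gaussianTilt {A B : Matrix ι ι ℝ} (hA : A.IsHermitian)
    (hB : B.IsHermitian) (hA1 : ‖A‖ < 1) (hB1 : ‖B‖ < 1) :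
    ∫⁻ x, gaussianTilt (1 + A) x * gaussianTilt (1 + B) x
      ∂(stdGaussian (EuclideanSpace ℝ ι)) = ENNReal.ofReal (√(1 - A * B).det)⁻¹ := by
  have hA' := posDef_one_add_of_l2_opNorm_lt_one hA hA1
  have hB' := posDef_one_add_of_l2_opNorm_lt_one hB hB1
  let K : Matrix ι ι ℝ := 1 + 1 - (1 + A)⁻¹ - (1 + B)⁻¹
  have hK : (1 - K).PosDef := by
    convert (posDef_inv_one_add_sub_half hA hA1).add (posDef_inv_one_add_sub_half hB hB1) using 1
    simp only [K]
    module
  have hdet : (1 + A).det * (1 - K).det * (1 + B).det = (1 - A * B).det := by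
    rw [← det_mul, ← det_mul]
    congr 1
    calc (1 + A) * (1 - K) * (1 + B)
        = (1 + A) * (1 + A)⁻¹ * (1 + B) + (1 + A) * ((1 + B)⁻¹ * (1 + B))
            - (1 + A) * (1 + B) := by
          simp only [K]
          generalize (1 + A)⁻¹ = X
          generalize (1 + B)⁻¹ = Y
          noncomm_ring
      _ = 1 - A * B := by
          rw [mul_nonsing_inv _ hA'.det_pos.ne'.isUnit, nonsing_inv_mul _ hB'.det_pos.ne'.isUnit]
          noncomm_ring
  simp_rw [gaussianTilt_mul_gaussianTilt]
  rw [lintegral_const_mul' _ _ ENNReal.ofReal_ne_top, lintegral_exp_quadraticForm_stdGaussian hK,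
    ← ENNReal.ofReal_mul (by positivity), ← hdet,
    Real.sqrt_mul (mul_pos hA'.det_pos hK.det_pos).le, Real.sqrt_mul hA'.det_pos.le, mul_inv,
    mul_inv]
  congr 1
  ring

end GaussianIntegrals

section Determinants

variable {ι : Type*} [Fintype ι] [DecidableEq ι]

lemma trace_le_card_mul_l2_opNorm (M : Matrix ι ι ℝ) : M.trace ≤ Fintype.card ι * ‖M‖ := by
  rw [trace, ← nsmul_eq_mul, ← Finset.card_univ]
  refine Finset.sum_le_card_nsmul _ _ _ fun i _ => ?_
  simpa using dotProduct_mulVec_le_l2_opNorm M (Pi.single i 1)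

lemma abs_trace_le_card_mul_l2_opNorm (M : Matrix ι ι ℝ) :
    |M.trace| ≤ Fintype.card ι * ‖M‖ :=
  abs_le'.2 ⟨trace_le_card_mul_l2_opNorm M, by simpa using trace_le_card_mul_l2_opNorm (-M)⟩

lemma l2_opNorm_sq_le_sum_sq (M : Matrix ι ι ℝ) : ‖M‖ ^ 2 ≤ ∑ i, ∑ j, M i j ^ 2 := by
  have hsum : 0 ≤ ∑ i, ∑ j, M i j ^ 2 := by positivity
  suffices hM : ‖M‖ ≤ √(∑ i, ∑ j, M i j ^ 2) from
    (Real.le_sqrt (norm_nonneg M) hsum).1 hM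
  rw [cstar_norm_def]
  refine ContinuousLinearMap.opNorm_le_bound _ (Real.sqrt_nonneg _) fun x => ?_
  rw [EuclideanSpace.norm_eq, EuclideanSpace.norm_eq, ← Real.sqrt_mul hsum, Finset.sum_mul]
  refine Real.sqrt_le_sqrt (Finset.sum_le_sum fun i _ => ?_)
  simp only [ofLp_toEuclideanCLM, Real.norm_eq_abs, sq_abs, mulVec, dotProduct]
  exact Finset.sum_mul_sq_le_sq_mul_sq _ _ _

section Hermitian

variable {S : Matrix ι ι ℝ}

lemma det_one_sub_eq_prod_eigenvalues (hS : S.IsHermitian) :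
    (1 - S).det = ∏ i, (1 - hS.eigenvalues i) := by
  have h := eval_charpoly S 1
  rw [hS.charpoly_eq, Polynomial.eval_prod] at h
  simpa using h.symm

lemma trace_pow_eq_sum_eigenvalues_pow (hS : S.IsHermitian) (n : ℕ) :
    (S ^ n).trace = ∑ i, hS.eigenvalues i ^ n := by
  conv_lhs => rw [hS.spectral_theorem]
  rw [← map_pow, Unitary.conjStarAlgAut_apply, trace_mul_cycle, Unitary.coe_star_mul_self, one_mul,
    diagonal_pow, trace_diagonal]
  rfl

lemma abs_eigenvalues_le_l2_opNorm (hS : S.IsHermitian) (i : ι) : |hS.eigenvalues i| ≤ ‖S‖ :=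
  have : Nonempty ι := ⟨i⟩
  spectrum.norm_le_norm_of_mem (hS.eigenvalues_mem_spectrum_real i)

/- The truncation at order `n` of `log det (1 - S) = -∑ₖ tr Sᵏ / k`. -/
lemma exp_neg_sum_trace_pow_le_det_one_sub (hS : S.IsHermitian) (h : ‖S‖ < 1) (n : ℕ) :
    Real.exp (-∑ k ∈ Finset.range n, (S ^ (k + 1)).trace / (k + 1)
      - (∑ i, |hS.eigenvalues i| ^ (n + 1)) / (1 - ‖S‖)) ≤ (1 - S).det := by
  have hexponent : -∑ k ∈ Finset.range n, (S ^ (k + 1)).trace / (k + 1)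
      - (∑ i, |hS.eigenvalues i| ^ (n + 1)) / (1 - ‖S‖) =
        ∑ i, (-∑ k ∈ Finset.range n, hS.eigenvalues i ^ (k + 1) / (k + 1)
          - |hS.eigenvalues i| ^ (n + 1) / (1 - ‖S‖)) := by
    simp_rw [trace_pow_eq_sum_eigenvalues_pow hS, Finset.sum_div]
    rw [Finset.sum_comm, ← Finset.sum_neg_distrib, ← Finset.sum_sub_distrib]
  rw [hexponent, det_one_sub_eq_prod_eigenvalues hS, Real.exp_sum]
  refine Finset.prod_le_prod (fun _ _ => (Real.exp_pos _).le) fun i _ => ?_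
  have hle := abs_eigenvalues_le_l2_opNorm hS i
  have hlt := hle.trans_lt h
  rw [← Real.le_log_iff_exp_le (by linarith [(abs_lt.1 hlt).2])]
  have htaylor := (abs_le.1 (Real.abs_log_sub_add_sum_range_le hlt n)).1
  have herror : |hS.eigenvalues i| ^ (n + 1) / (1 - |hS.eigenvalues i|) ≤
      |hS.eigenvalues i| ^ (n + 1) / (1 - ‖S‖) := by
    gcongr
  linarith

lemma exp_le_det_one_sub (hS : S.IsHermitian) (h : ‖S‖ ≤ 1 / 2) :
    Real.exp (-S.trace - 2 * (S ^ 2).trace) ≤ (1 - S).det := by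
  refine le_trans (Real.exp_le_exp.2 ?_)
    (exp_neg_sum_trace_pow_le_det_one_sub hS (h.trans_lt (by norm_num)) 1)
  have herror : (∑ i, |hS.eigenvalues i| ^ (1 + 1)) / (1 - ‖S‖) ≤ 2 * (S ^ 2).trace := by
    simp only [one_add_one_eq_two, sq_abs, ← trace_pow_eq_sum_eigenvalues_pow hS]
    have : 0 ≤ (S ^ 2).trace := by rw [trace_pow_eq_sum_eigenvalues_pow hS]; positivity
    rw [div_le_iff₀ (by linarith)]
    nlinarith
  simp only [Finset.sum_range_one, zero_add, pow_one, CharP.cast_eq_zero, div_one]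
  linarith

lemma exp_le_det_one_sub_of_cubic (hS : S.IsHermitian) (h : ‖S‖ ≤ 1 / 2) :
    Real.exp (-S.trace - (S ^ 2).trace / 2 - 2 * (Fintype.card ι * ‖S‖ ^ 3)) ≤ (1 - S).det := by
  refine le_trans (Real.exp_le_exp.2 ?_)
    (exp_neg_sum_trace_pow_le_det_one_sub hS (h.trans_lt (by norm_num)) 2)
  have hsum : ∑ i, |hS.eigenvalues i| ^ (2 + 1) ≤ Fintype.card ι * ‖S‖ ^ 3 := by
    rw [← nsmul_eq_mul, ← Finset.card_univ]
    refine Finset.sum_le_card_nsmul _ _ _ fun i _ => ?_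
    gcongr
    exact abs_eigenvalues_le_l2_opNorm hS i
  have herror : (∑ i, |hS.eigenvalues i| ^ (2 + 1)) / (1 - ‖S‖) ≤
      2 * (Fintype.card ι * ‖S‖ ^ 3) := by
    have : 0 ≤ Fintype.card ι * ‖S‖ ^ 3 := by positivity
    rw [div_le_iff₀ (by linarith)]
    nlinarith
  simp only [Finset.sum_range_succ, Finset.sum_range_zero, zero_add, pow_one,
    CharP.cast_eq_zero, div_one, Nat.cast_one, one_add_one_eq_two]
  linarith

end Hermitian

end Determinants

section GramDefect

variable {ι : Type*} [Fintype ι]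

/-- The symmetric matrix `S` with `1 - S = (1 - M) (1 - M)ᵀ`, through which bounds on determinants
of symmetric matrices are transferred to a general `M`. -/
def gramDefect (M : Matrix ι ι ℝ) : Matrix ι ι ℝ := M + Mᵀ - M * Mᵀ

lemma isHermitian_gramDefect (M : Matrix ι ι ℝ) : (gramDefect M).IsHermitian := by
  rw [IsHermitian, conjTranspose_eq_transpose_of_trivial, gramDefect]
  simp [add_comm]

lemma trace_gramDefect (M : Matrix ι ι ℝ) :
    (gramDefect M).trace = 2 * M.trace - (M * Mᵀ).trace := by
  rw [gramDefect, trace_sub, trace_add, trace_transpose]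
  ring

variable [DecidableEq ι]

lemma det_one_sub_gramDefect (M : Matrix ι ι ℝ) : (1 - gramDefect M).det = (1 - M).det ^ 2 := by
  have hfactor : 1 - gramDefect M = (1 - M) * (1 - M)ᵀ := by
    rw [gramDefect, transpose_sub, transpose_one]
    noncomm_ring
  rw [hfactor, det_mul, det_transpose, pow_two]

lemma l2_opNorm_transpose (M : Matrix ι ι ℝ) : ‖Mᵀ‖ = ‖M‖ := by
  rw [← conjTranspose_eq_transpose_of_trivial, l2_opNorm_conjTranspose]

lemma l2_opNorm_mul_transpose_le (M : Matrix ι ι ℝ) : ‖M * Mᵀ‖ ≤ ‖M‖ ^ 2 :=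
  (norm_mul_le _ _).trans_eq (by rw [l2_opNorm_transpose, pow_two])

lemma l2_opNorm_add_transpose_le (M : Matrix ι ι ℝ) : ‖M + Mᵀ‖ ≤ 2 * ‖M‖ :=
  (norm_add_le _ _).trans_eq (by rw [l2_opNorm_transpose, two_mul])

lemma l2_opNorm_gramDefect_le {M : Matrix ι ι ℝ} (h : ‖M‖ ≤ 1) : ‖gramDefect M‖ ≤ 3 * ‖M‖ := by
  calc ‖gramDefect M‖ ≤ ‖M + Mᵀ‖ + ‖M * Mᵀ‖ := norm_sub_le _ _
    _ ≤ 2 * ‖M‖ + ‖M‖ ^ 2 :=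
        add_le_add (l2_opNorm_add_transpose_le M) (l2_opNorm_mul_transpose_le M)
    _ ≤ 3 * ‖M‖ := by nlinarith [norm_nonneg M]

lemma trace_gramDefect_sq_le {M : Matrix ι ι ℝ} (h : ‖M‖ ≤ 1) :
    (gramDefect M ^ 2).trace ≤
      2 * (M ^ 2).trace + 2 * (M * Mᵀ).trace + 5 * (Fintype.card ι * ‖M‖ ^ 3) := by
  let R := M * Mᵀ * (M * Mᵀ) - (M + Mᵀ) * (M * Mᵀ) - M * Mᵀ * (M + Mᵀ)
  have hsum := l2_opNorm_add_transpose_le M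
  have hprod := l2_opNorm_mul_transpose_le M
  have hR : ‖R‖ ≤ 5 * ‖M‖ ^ 3 := by
    calc ‖R‖ ≤ ‖M * Mᵀ‖ * ‖M * Mᵀ‖ + ‖M + Mᵀ‖ * ‖M * Mᵀ‖ + ‖M * Mᵀ‖ * ‖M + Mᵀ‖ := by
          refine (norm_sub_le _ _).trans (add_le_add ((norm_sub_le _ _).trans ?_) ?_)
          · gcongr <;> exact norm_mul_le _ _
          · exact norm_mul_le _ _
      _ ≤ ‖M‖ ^ 2 * ‖M‖ ^ 2 + 2 * ‖M‖ * ‖M‖ ^ 2 + ‖M‖ ^ 2 * (2 * ‖M‖) := by gcongr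
      _ ≤ 5 * ‖M‖ ^ 3 := by nlinarith [pow_nonneg (norm_nonneg M) 3]
  have hexpand : gramDefect M ^ 2 = M ^ 2 + M * Mᵀ + (Mᵀ * M + Mᵀ * Mᵀ) + R := by
    simp only [gramDefect, R]
    noncomm_ring
  have htranspose : (Mᵀ * Mᵀ).trace = (M ^ 2).trace := by
    rw [← transpose_mul, trace_transpose, pow_two]
  have htraceR : R.trace ≤ Fintype.card ι * (5 * ‖M‖ ^ 3) :=
    (trace_le_card_mul_l2_opNorm R).trans (by gcongr)
  rw [hexpand, trace_add, trace_add, trace_add, trace_add, htranspose, trace_mul_comm Mᵀ M]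
  linarith

lemma inv_sqrt_det_one_sub_le {M : Matrix ι ι ℝ} (h : ‖M‖ ≤ 1 / 6) :
    (√(1 - M).det)⁻¹ ≤
      Real.exp (M.trace / 2 + (M ^ 2).trace / 4 + 15 * (Fintype.card ι * ‖M‖ ^ 3)) := by
  let u := M.trace / 2 + (M ^ 2).trace / 4 + 15 * (Fintype.card ι * ‖M‖ ^ 3)
  have hnorm := l2_opNorm_gramDefect_le (h.trans (by norm_num))
  have htrace := trace_gramDefect_sq_le (h.trans (by norm_num))
  have hcube : Fintype.card ι * ‖gramDefect M‖ ^ 3 ≤ Fintype.card ι * (3 * ‖M‖) ^ 3 := by gcongr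
  have hcube_nonneg : 0 ≤ Fintype.card ι * ‖M‖ ^ 3 := by positivity
  have hsq : Real.exp (-(2 * u)) ^ 2 ≤ (1 - M).det ^ 2 := by
    rw [← det_one_sub_gramDefect, ← Real.exp_nat_mul]
    refine le_trans (Real.exp_le_exp.2 ?_)
      (exp_le_det_one_sub_of_cubic (isHermitian_gramDefect M) (by linarith))
    rw [trace_gramDefect]
    simp only [u]
    push_cast
    linarith
  rcases le_or_gt (1 - M).det 0 with hdet | hdet
  · rw [Real.sqrt_eq_zero_of_nonpos hdet, _root_.inv_zero]
    exact (Real.exp_pos _).le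
  have hsqrt : Real.exp (-u) ≤ √(1 - M).det := by
    have hle := Real.sqrt_le_sqrt ((sq_le_sq₀ (Real.exp_pos _).le hdet.le).1 hsq)
    rwa [← Real.exp_half, neg_div, mul_div_cancel_left₀ _ (two_ne_zero' ℝ)] at hle
  rw [inv_le_comm₀ (Real.sqrt_pos.2 hdet) (Real.exp_pos _), ← Real.exp_neg]
  exact hsqrt

end GramDefect

lemma sum_sq_eq_trace_sq {ι : Type*} [Fintype ι] [DecidableEq ι] {K : Matrix ι ι ℝ}
    (hK : K.IsHermitian) :
    ∑ i, ∑ j, K i j ^ 2 = (K ^ 2).trace := by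
  simp only [trace, diag, pow_two, mul_apply]
  refine Finset.sum_congr rfl fun i _ => Finset.sum_congr rfl fun j _ => ?_
  rw [← hK.apply i j, star_trivial]

lemma lintegral_exp_quadraticForm_le {ι : Type*} [Fintype ι] {K : Matrix ι ι ℝ}
    (hK : K.IsHermitian) (h : ∑ i, ∑ j, K i j ^ 2 ≤ 1 / 16) :
    ∫⁻ x, ENNReal.ofReal (Real.exp (x.ofLp ⬝ᵥ K *ᵥ x.ofLp)) ∂(stdGaussian (EuclideanSpace ℝ ι)) ≤
      ENNReal.ofReal (Real.exp (K.trace + 4 * ∑ i, ∑ j, K i j ^ 2)) := by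
  classical
  have hnorm : ‖(2 : ℝ) • K‖ ≤ 1 / 2 := by
    have := (l2_opNorm_sq_le_sum_sq K).trans h
    rw [norm_smul, Real.norm_ofNat]
    nlinarith [norm_nonneg K]
  have hherm : ((2 : ℝ) • K).IsHermitian := hK.smul (IsSelfAdjoint.all 2)
  have hquad (x : EuclideanSpace ℝ ι) :
      x.ofLp ⬝ᵥ K *ᵥ x.ofLp = (x.ofLp ⬝ᵥ ((2 : ℝ) • K) *ᵥ x.ofLp) / 2 := by
    rw [smul_mulVec, dotProduct_smul, smul_eq_mul]
    ring
  have hexponent : K.trace + 4 * (K ^ 2).trace =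
      -((-((2 : ℝ) • K).trace - 2 * (((2 : ℝ) • K) ^ 2).trace) / 2) := by
    rw [smul_pow, trace_smul, trace_smul, smul_eq_mul, smul_eq_mul]
    ring
  simp_rw [hquad]
  rw [lintegral_exp_quadraticForm_stdGaussian
    (posDef_one_sub_of_l2_opNorm_lt_one hherm (by linarith)), sum_sq_eq_trace_sq hK, hexponent,
    Real.exp_neg, Real.exp_half]
  gcongr
  exact exp_le_det_one_sub hherm hnorm

section MixtureKernel

lemma exp_le_one_add_add_sq_mul_exp {u U : ℝ} (h : |u| ≤ U) :
    Real.exp u ≤ 1 + u + u ^ 2 * Real.exp U := by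
  have hcomplex := Complex.norm_exp_sub_sum_le_norm_mul_exp (u : ℂ) 2
  have hreal : |Real.exp u - (1 + u)| ≤ u ^ 2 * Real.exp |u| := by
    have hcast : Complex.exp u - ∑ m ∈ Finset.range 2, (u : ℂ) ^ m / m.factorial =
        ((Real.exp u - (1 + u) : ℝ) : ℂ) := by simp [Finset.sum_range_succ]
    simpa only [hcast, Complex.norm_real, Real.norm_eq_abs, sq_abs] using hcomplex
  calc Real.exp u ≤ 1 + u + u ^ 2 * Real.exp |u| := by linarith [(abs_le.1 hreal).2]
    _ ≤ 1 + u + u ^ 2 * Real.exp U := by gcongr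

variable {κ : Type*} [Fintype κ]

lemma sum_mul_exp_le_exp {p u : κ → ℝ} (hp : ∀ k, 0 ≤ p k) (hp1 : ∑ k, p k = 1) {U : ℝ}
    (hu : ∀ k, |u k| ≤ U) :
    ∑ k, p k * Real.exp (u k) ≤
      Real.exp (∑ k, p k * u k + Real.exp U * ∑ k, p k * u k ^ 2) := by
  calc ∑ k, p k * Real.exp (u k)
      ≤ ∑ k, p k * (1 + u k + u k ^ 2 * Real.exp U) := by
        gcongr with k
        · exact hp k
        · exact exp_le_one_add_add_sq_mul_exp (hu k)
    _ = (∑ k, p k * u k + Real.exp U * ∑ k, p k * u k ^ 2) + 1 := by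
        simp_rw [mul_add, mul_one, Finset.sum_add_distrib, hp1, ← mul_assoc, ← Finset.sum_mul]
        ring
    _ ≤ _ := Real.add_one_le_exp _

variable (w s : κ → ℝ)

/-- The chi-squared inner product, relative to `N(0, I)`, of the mixtures `∑ₖ wₖ N(0, I + sₖ A)` and
`∑ₖ wₖ N(0, I + sₖ B)`, as a function of `M = A B`. -/
def mixtureKernel {ι : Type*} [Fintype ι] [DecidableEq ι] (M : Matrix ι ι ℝ) : ℝ :=
  ∑ q : κ × κ, w q.1 * w q.2 * (√(1 - (s q.1 * s q.2) • M).det)⁻¹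

variable {w s}

lemma sum_prod_weights (hw1 : ∑ k, w k = 1) : ∑ q : κ × κ, w q.1 * w q.2 = 1 := by
  rw [Fintype.sum_prod_type, ← Finset.sum_mul_sum, hw1, one_mul]

/- Centring of the scales removes the term that is linear in `x`. -/
lemma sum_prod_weights_mul_quadratic (hws : ∑ k, w k * s k = 0) (x y : ℝ) :
    ∑ q : κ × κ, w q.1 * w q.2 * (s q.1 * s q.2 * x / 2 + (s q.1 * s q.2) ^ 2 * y / 4) =
      (∑ k, w k * s k ^ 2) ^ 2 / 4 * y := by
  have hsplit (q : κ × κ) :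
      w q.1 * w q.2 * (s q.1 * s q.2 * x / 2 + (s q.1 * s q.2) ^ 2 * y / 4) =
        w q.1 * s q.1 * (w q.2 * s q.2) * (x / 2) +
          w q.1 * s q.1 ^ 2 * (w q.2 * s q.2 ^ 2) * (y / 4) := by ring
  simp_rw [hsplit, Finset.sum_add_distrib, ← Finset.sum_mul, Fintype.sum_prod_type,
    ← Finset.sum_mul_sum, hws]
  ring

lemma abs_quadratic_le {t σ x y X Y : ℝ} (ht : |t| ≤ σ) (hx : |x| ≤ X) (hy : |y| ≤ Y) :
    |t * x / 2 + t ^ 2 * y / 4| ≤ σ * X + σ ^ 2 * Y := by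
  have hlinear : |t * x| ≤ σ * X := by rw [abs_mul]; gcongr; exact (abs_nonneg t).trans ht
  have hquadratic : |t ^ 2 * y| ≤ σ ^ 2 * Y := by rw [abs_mul, abs_pow]; gcongr
  rw [abs_le] at *
  constructor <;> linarith

lemma sq_quadratic_le {t σ : ℝ} (ht : |t| ≤ σ) (x y : ℝ) :
    (t * x / 2 + t ^ 2 * y / 4) ^ 2 ≤ (σ ^ 2 + σ ^ 4) * (x ^ 2 + y ^ 2) := by
  have ht2 : t ^ 2 ≤ σ ^ 2 := sq_le_sq' (abs_le.1 ht).1 (abs_le.1 ht).2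
  calc (t * x / 2 + t ^ 2 * y / 4) ^ 2 ≤ (t ^ 2 + (t ^ 2) ^ 2) * (x ^ 2 + y ^ 2) := by
        nlinarith [sq_nonneg (2 * (t * x) - t ^ 2 * y), sq_nonneg (t * x), sq_nonneg (t ^ 2 * y),
          sq_nonneg (t * y), sq_nonneg (t ^ 2 * x)]
    _ ≤ (σ ^ 2 + (σ ^ 2) ^ 2) * (x ^ 2 + y ^ 2) := by gcongr
    _ = (σ ^ 2 + σ ^ 4) * (x ^ 2 + y ^ 2) := by ring

lemma inv_sqrt_det_one_sub_smul_le {ι : Type*} [Fintype ι] [DecidableEq ι] {M : Matrix ι ι ℝ}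
    {t σ : ℝ} (ht : |t| ≤ σ) (hM : σ * ‖M‖ ≤ 1 / 6) :
    (√(1 - t • M).det)⁻¹ ≤ Real.exp (t * M.trace / 2 + t ^ 2 * (M ^ 2).trace / 4 +
      15 * (Fintype.card ι * (σ * ‖M‖) ^ 3)) := by
  have hnorm : ‖t • M‖ ≤ σ * ‖M‖ := by
    rw [norm_smul, Real.norm_eq_abs]
    gcongr
  refine (inv_sqrt_det_one_sub_le (hnorm.trans hM)).trans (Real.exp_le_exp.2 ?_)
  rw [smul_pow, trace_smul, trace_smul, smul_eq_mul, smul_eq_mul]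
  gcongr

lemma mixtureKernel_le_exp {ι : Type*} [Fintype ι] [DecidableEq ι] {M : Matrix ι ι ℝ}
    (hw : ∀ k, 0 ≤ w k) (hw1 : ∑ k, w k = 1) (hws : ∑ k, w k * s k = 0) {σ X Y : ℝ}
    (hσ : ∀ k l, |s k * s l| ≤ σ) (hM : σ * ‖M‖ ≤ 1 / 6) (hX : |M.trace| ≤ X)
    (hY : |(M ^ 2).trace| ≤ Y) :
    mixtureKernel w s M ≤ Real.exp ((∑ k, w k * s k ^ 2) ^ 2 / 4 * (M ^ 2).trace +
      Real.exp (σ * X + σ ^ 2 * Y) * ((σ ^ 2 + σ ^ 4) * (M.trace ^ 2 + (M ^ 2).trace ^ 2)) +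
      15 * (Fintype.card ι * (σ * ‖M‖) ^ 3)) := by
  let p (q : κ × κ) : ℝ := w q.1 * w q.2
  let t (q : κ × κ) : ℝ := s q.1 * s q.2
  let u (q : κ × κ) : ℝ := t q * M.trace / 2 + t q ^ 2 * (M ^ 2).trace / 4
  let e : ℝ := 15 * (Fintype.card ι * (σ * ‖M‖) ^ 3)
  have hp (q : κ × κ) : 0 ≤ p q := mul_nonneg (hw q.1) (hw q.2)
  have ht (q : κ × κ) : |t q| ≤ σ := hσ q.1 q.2
  have hdet (q : κ × κ) : (√(1 - t q • M).det)⁻¹ ≤ Real.exp (u q) * Real.exp e := by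
    rw [← Real.exp_add]
    exact inv_sqrt_det_one_sub_smul_le (ht q) hM
  have hu (q : κ × κ) : |u q| ≤ σ * X + σ ^ 2 * Y := abs_quadratic_le (ht q) hX hY
  have hsq (q : κ × κ) :
      u q ^ 2 ≤ (σ ^ 2 + σ ^ 4) * (M.trace ^ 2 + (M ^ 2).trace ^ 2) := sq_quadratic_le (ht q) _ _
  calc mixtureKernel w s M ≤ ∑ q, p q * (Real.exp (u q) * Real.exp e) := by
        unfold mixtureKernel
        gcongr with q
        · exact hp q
        · exact hdet q
    _ = (∑ q, p q * Real.exp (u q)) * Real.exp e := by simp_rw [← mul_assoc, ← Finset.sum_mul]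
    _ ≤ Real.exp (∑ q, p q * u q + Real.exp (σ * X + σ ^ 2 * Y) * ∑ q, p q * u q ^ 2) *
          Real.exp e := by
        gcongr
        exact sum_mul_exp_le_exp hp (sum_prod_weights hw1) hu
    _ ≤ _ := by
        rw [← Real.exp_add, sum_prod_weights_mul_quadratic hws]
        gcongr
        calc ∑ q, p q * u q ^ 2
            ≤ ∑ q, p q * ((σ ^ 2 + σ ^ 4) * (M.trace ^ 2 + (M ^ 2).trace ^ 2)) := by
              gcongr with q
              · exact hp q
              · exact hsq q
          _ = _ := by rw [← Finset.sum_mul, sum_prod_weights hw1, one_mul]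

lemma abs_mul_le_sum_sq (s : κ → ℝ) (k l : κ) : |s k * s l| ≤ ∑ j, s j ^ 2 := by
  have hle (i : κ) : s i ^ 2 ≤ ∑ j, s j ^ 2 :=
    Finset.single_le_sum (fun j _ => sq_nonneg (s j)) (Finset.mem_univ i)
  rw [abs_mul]
  nlinarith [two_mul_le_add_sq |s k| |s l|, sq_abs (s k), sq_abs (s l), hle k, hle l]

lemma l2_opNorm_mul_le_sq_div {d : ℕ} {A B : Matrix (Fin d) (Fin d) ℝ} {C : ℝ}
    (hA : ‖A‖ ≤ C / √d) (hB : ‖B‖ ≤ C / √d) : ‖A * B‖ ≤ C ^ 2 / d := by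
  calc ‖A * B‖ ≤ ‖A‖ * ‖B‖ := norm_mul_le _ _
    _ ≤ C / √d * (C / √d) := by
        gcongr
        exact (norm_nonneg A).trans hA
    _ = C ^ 2 / d := by rw [div_mul_div_comm, Real.mul_self_sqrt d.cast_nonneg, pow_two]

lemma abs_trace_pow_le {d : ℕ} {M : Matrix (Fin d) (Fin d) ℝ} {K : ℝ} (hM : ‖M‖ ≤ K / d)
    {n : ℕ} (hn : 0 < n) : |(M ^ n).trace| ≤ d * (K / d) ^ n := by
  calc |(M ^ n).trace| ≤ d * ‖M ^ n‖ :=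
        (abs_trace_le_card_mul_l2_opNorm _).trans_eq (by rw [Fintype.card_fin])
    _ ≤ d * (K / d) ^ n := by
        gcongr
        exact (norm_pow_le' M hn).trans (by gcongr)

lemma mixtureKernel_le_of_l2_opNorm_le {d : ℕ} (hd : d ≠ 0) (hw : ∀ k, 0 ≤ w k)
    (hw1 : ∑ k, w k = 1) (hws : ∑ k, w k * s k = 0) {σ K V : ℝ} (hσ : ∀ k l, |s k * s l| ≤ σ)
    (hV : Real.exp (σ * K + σ ^ 2 * K ^ 2) * (σ ^ 2 + σ ^ 4) = V) (hd_large : 6 * σ * K ≤ d)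
    {M : Matrix (Fin d) (Fin d) ℝ} (hM : ‖M‖ ≤ K / d) :
    mixtureKernel w s M ≤ Real.exp (V * M.trace ^ 2 +
      (∑ k, w k * s k ^ 2) ^ 2 / 4 * (M ^ 2).trace + (V * K ^ 4 + 15 * (σ * K) ^ 3) / d ^ 2) := by
  have hd1 : (1 : ℝ) ≤ d := by exact_mod_cast Nat.one_le_iff_ne_zero.2 hd
  have hd0 : (0 : ℝ) < d := by linarith
  have hσ0 : 0 ≤ σ := by
    obtain ⟨k, -, -⟩ := Finset.exists_ne_zero_of_sum_ne_zero (hw1.trans_ne one_ne_zero)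
    exact (abs_nonneg _).trans (hσ k k)
  have hV0 : 0 ≤ V := hV ▸ by positivity
  have hsmall : σ * ‖M‖ ≤ 1 / 6 := by
    calc σ * ‖M‖ ≤ σ * (K / d) := by gcongr
      _ ≤ 1 / 6 := by rw [← mul_div_assoc, div_le_iff₀ hd0]; linarith
  have htrace : |M.trace| ≤ K := by
    simpa only [pow_one, mul_div_cancel₀ K hd0.ne'] using abs_trace_pow_le hM one_pos
  have htrace_sq : |(M ^ 2).trace| ≤ K ^ 2 / d :=
    (abs_trace_pow_le hM two_pos).trans_eq (by field_simp)
  have htrace_fourth : (M ^ 2).trace ^ 2 ≤ K ^ 4 / d ^ 2 := by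
    calc (M ^ 2).trace ^ 2 ≤ (K ^ 2 / d) ^ 2 :=
          sq_le_sq' (abs_le.1 htrace_sq).1 (abs_le.1 htrace_sq).2
      _ = K ^ 4 / d ^ 2 := by ring
  have hcube : 15 * (Fintype.card (Fin d) * (σ * ‖M‖) ^ 3) ≤ 15 * (σ * K) ^ 3 / d ^ 2 := by
    calc 15 * (Fintype.card (Fin d) * (σ * ‖M‖) ^ 3) ≤ 15 * (d * (σ * (K / d)) ^ 3) := by
          rw [Fintype.card_fin]; gcongr
      _ = _ := by field_simp
  have hvariance : V * (M.trace ^ 2 + (M ^ 2).trace ^ 2) ≤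
      V * M.trace ^ 2 + V * K ^ 4 / d ^ 2 := by
    rw [mul_add, mul_div_assoc]
    gcongr
  refine (mixtureKernel_le_exp hw hw1 hws hσ hsmall htrace
    (htrace_sq.trans (div_le_self (by positivity) hd1))).trans (Real.exp_le_exp.2 ?_)
  rw [add_div, ← mul_assoc, hV]
  linarith

lemma exists_mixtureKernel_le (hw : ∀ k, 0 ≤ w k) (hw1 : ∑ k, w k = 1)
    (hws : ∑ k, w k * s k = 0) (C : ℝ) :
    ∃ L : ℝ, 0 ≤ L ∧ ∀ᶠ d : ℕ in atTop, ∀ A B : Matrix (Fin d) (Fin d) ℝ,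
      ‖A‖ ≤ C / √d → ‖B‖ ≤ C / √d →
        mixtureKernel w s (A * B) ≤ Real.exp (L * (A * B).trace ^ 2 +
          (∑ k, w k * s k ^ 2) ^ 2 / 4 * ((A * B) ^ 2).trace + L / d ^ 2) := by
  let σ : ℝ := ∑ k, s k ^ 2
  let V : ℝ := Real.exp (σ * C ^ 2 + σ ^ 2 * (C ^ 2) ^ 2) * (σ ^ 2 + σ ^ 4)
  let W : ℝ := V * (C ^ 2) ^ 4 + 15 * (σ * C ^ 2) ^ 3
  have hV : 0 ≤ V := by positivity
  have hW : 0 ≤ W := by positivity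
  refine ⟨V + W, by positivity, ?_⟩
  have hlarge : ∀ᶠ d : ℕ in atTop, 6 * σ * C ^ 2 ≤ (d : ℝ) :=
    tendsto_natCast_atTop_atTop.eventually_ge_atTop _
  filter_upwards [hlarge, eventually_ne_atTop 0] with d hd_large hd A B hA hB
  calc mixtureKernel w s (A * B) ≤ Real.exp (V * (A * B).trace ^ 2 +
        (∑ k, w k * s k ^ 2) ^ 2 / 4 * ((A * B) ^ 2).trace + W / d ^ 2) :=
        mixtureKernel_le_of_l2_opNorm_le hd hw hw1 hws (abs_mul_le_sum_sq s) rfl hd_large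
          (l2_opNorm_mul_le_sq_div hA hB)
    _ ≤ _ := by gcongr <;> linarith

end MixtureKernel

section SecondMoment

variable {Γ Ω : Type*} [MeasurableSpace Γ] [MeasurableSpace Ω]

lemma chiSq_withDensity {P : Measure Ω} [SigmaFinite P] {h : Ω → ℝ≥0∞} (hm : Measurable h)
    [SigmaFinite (P.withDensity h)] :
    chiSq P (P.withDensity h) (P.withDensity h) = ∫⁻ ω, h ω * h ω ∂P := by
  rw [chiSq_eq_of_ac _ _ _ (withDensity_absolutelyContinuous _ _)
    (withDensity_absolutelyContinuous _ _)]
  refine lintegral_congr_ae ?_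
  filter_upwards [Measure.rnDeriv_withDensity P hm] with ω hω
  rw [hω]

lemma two_mul_le_mul_self_add_one (t : ℝ≥0∞) : 2 * t ≤ t * t + 1 := by
  induction t with
  | top => simp
  | coe t => exact_mod_cast (by simpa [sq] using two_mul_le_add_sq t 1 : 2 * t ≤ t * t + 1)

lemma one_le_chiSq_self {P Q : Measure Ω} [IsProbabilityMeasure P] [IsProbabilityMeasure Q]
    (hQ : Q ≪ P) : 1 ≤ chiSq P Q Q := by
  have hmass : ∫⁻ ω, Q.rnDeriv P ω ∂P = 1 := by rw [Measure.lintegral_rnDeriv hQ, measure_univ]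
  have hsum : (1 : ℝ≥0∞) + 1 ≤ ∫⁻ ω, Q.rnDeriv P ω * Q.rnDeriv P ω ∂P + 1 :=
    calc (1 : ℝ≥0∞) + 1 = ∫⁻ ω, 2 * Q.rnDeriv P ω ∂P := by
          rw [lintegral_const_mul _ (Measure.measurable_rnDeriv Q P), hmass, mul_one,
            one_add_one_eq_two]
      _ ≤ ∫⁻ ω, (Q.rnDeriv P ω * Q.rnDeriv P ω + 1) ∂P :=
          lintegral_mono fun ω => two_mul_le_mul_self_add_one _
      _ = ∫⁻ ω, Q.rnDeriv P ω * Q.rnDeriv P ω ∂P + 1 := by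
          rw [lintegral_add_right _ measurable_const, lintegral_const, measure_univ, one_mul]
  rw [chiSq_eq_of_ac _ _ _ hQ hQ]
  exact (ENNReal.add_le_add_iff_right ENNReal.one_ne_top).1 hsum

variable {ν : Measure Γ} {P : Measure Ω} {κ : Γ → Measure Ω} {F : Γ → Ω → ℝ≥0∞}

lemma measurable_withDensity_uncurry [SFinite P] (hF : Measurable (Function.uncurry F)) :
    Measurable fun γ => P.withDensity (F γ) := by
  refine Measure.measurable_of_measurable_coe _ fun s hs => ?_
  simp_rw [withDensity_apply _ hs]
  exact hF.lintegral_prod_right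

lemma bind_eq_withDensity [SFinite ν] [SFinite P] (hF : Measurable (Function.uncurry F))
    (hκ : ∀ᵐ γ ∂ν, κ γ = P.withDensity (F γ)) :
    ν.bind κ = P.withDensity fun ω => ∫⁻ γ, F γ ω ∂ν := by
  rw [Measure.bind, Measure.map_congr hκ]
  ext s hs
  rw [← Measure.bind, Measure.bind_apply hs (measurable_withDensity_uncurry hF).aemeasurable,
    withDensity_apply _ hs]
  simp_rw [withDensity_apply _ hs]
  exact lintegral_lintegral_swap hF.aemeasurable

lemma lintegral_lintegral_mul_self [SFinite ν] [SFinite P]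
    (hF : Measurable (Function.uncurry F)) :
    ∫⁻ ω, (∫⁻ γ, F γ ω ∂ν) * (∫⁻ γ, F γ ω ∂ν) ∂P =
      ∫⁻ γ, ∫⁻ γ', ∫⁻ ω, F γ ω * F γ' ω ∂P ∂ν ∂ν := by
  have hsection (ω : Ω) : Measurable fun γ => F γ ω :=
    hF.comp (f := fun γ => (γ, ω)) (by fun_prop)
  have hjoint : Measurable fun p : (Ω × Γ) × Γ => F p.1.2 p.1.1 * F p.2 p.1.1 :=
    (hF.comp (f := fun p : (Ω × Γ) × Γ => (p.1.2, p.1.1)) (by fun_prop)).mul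
      (hF.comp (f := fun p : (Ω × Γ) × Γ => (p.2, p.1.1)) (by fun_prop))
  have hexpand (ω : Ω) : (∫⁻ γ, F γ ω ∂ν) * (∫⁻ γ, F γ ω ∂ν) =
      ∫⁻ γ, ∫⁻ γ', F γ ω * F γ' ω ∂ν ∂ν := by
    simp_rw [lintegral_const_mul _ (hsection ω), lintegral_mul_const _ (hsection ω)]
  simp_rw [hexpand]
  rw [lintegral_lintegral_swap (f := fun ω γ => ∫⁻ γ', F γ ω * F γ' ω ∂ν)
    hjoint.lintegral_prod_right'.aemeasurable]
  refine lintegral_congr fun γ => ?_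
  refine lintegral_lintegral_swap (f := fun ω γ' => F γ ω * F γ' ω) (Measurable.aemeasurable ?_)
  exact hjoint.comp (f := fun p : Ω × Γ => ((p.1, γ), p.2)) (by fun_prop)

instance (N : ℕ) [IsProbabilityMeasure P] : IsProbabilityMeasure (iidSamples N P) := by
  unfold iidSamples
  infer_instance

lemma measurable_uncurry_prod (hF : Measurable (Function.uncurry F)) (N : ℕ) :
    Measurable (Function.uncurry fun γ (x : Fin N → Ω) => ∏ i, F γ (x i)) :=
  Finset.measurable_prod _ fun i _ =>
    hF.comp (f := fun p : Γ × (Fin N → Ω) => (p.1, p.2 i)) (by fun_prop)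

variable [IsProbabilityMeasure P] [∀ γ, IsProbabilityMeasure (κ γ)]

lemma iidSamples_ae_eq_withDensity (hF : Measurable (Function.uncurry F))
    (hκ : ∀ᵐ γ ∂ν, κ γ = P.withDensity (F γ)) (N : ℕ) :
    ∀ᵐ γ ∂ν, iidSamples N (κ γ) = (iidSamples N P).withDensity fun x => ∏ i, F γ (x i) := by
  filter_upwards [hκ] with γ hγ
  have : IsProbabilityMeasure (P.withDensity (F γ)) := hγ ▸ inferInstance
  rw [hγ]
  exact pi_withDensity fun _ => hF.comp (f := fun ω => (γ, ω)) (by fun_prop)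

variable [IsProbabilityMeasure ν]

lemma isProbabilityMeasure_bind_iidSamples (hF : Measurable (Function.uncurry F))
    (hκ : ∀ᵐ γ ∂ν, κ γ = P.withDensity (F γ)) (N : ℕ) :
    IsProbabilityMeasure (ν.bind fun γ => iidSamples N (κ γ)) :=
  isProbabilityMeasure_bind
    ((measurable_withDensity_uncurry (measurable_uncurry_prod hF N)).aemeasurable.congr
      (EventuallyEq.symm (iidSamples_ae_eq_withDensity hF hκ N)))
    (ae_of_all _ fun _ => inferInstance)

lemma one_le_chiSq_bind_iidSamples (hF : Measurable (Function.uncurry F))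
    (hκ : ∀ᵐ γ ∂ν, κ γ = P.withDensity (F γ)) (N : ℕ) :
    1 ≤ chiSq (iidSamples N P) (ν.bind fun γ => iidSamples N (κ γ))
      (ν.bind fun γ => iidSamples N (κ γ)) := by
  have := isProbabilityMeasure_bind_iidSamples hF hκ N
  refine one_le_chiSq_self ?_
  rw [bind_eq_withDensity (measurable_uncurry_prod hF N) (iidSamples_ae_eq_withDensity hF hκ N)]
  exact withDensity_absolutelyContinuous _ _

lemma chiSq_bind_iidSamples (hF : Measurable (Function.uncurry F))
    (hκ : ∀ᵐ γ ∂ν, κ γ = P.withDensity (F γ)) (N : ℕ) :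
    chiSq (iidSamples N P) (ν.bind fun γ => iidSamples N (κ γ))
        (ν.bind fun γ => iidSamples N (κ γ)) =
      ∫⁻ γ, ∫⁻ γ', (∫⁻ ω, F γ ω * F γ' ω ∂P) ^ N ∂ν ∂ν := by
  have hprob := isProbabilityMeasure_bind_iidSamples hF hκ N
  have hprod := measurable_uncurry_prod hF N
  have hmul (γ γ' : Γ) : Measurable fun ω => F γ ω * F γ' ω :=
    (hF.comp (f := fun ω => (γ, ω)) (by fun_prop)).mul
      (hF.comp (f := fun ω => (γ', ω)) (by fun_prop))
  rw [bind_eq_withDensity hprod (iidSamples_ae_eq_withDensity hF hκ N)] at hprob ⊢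
  rw [chiSq_withDensity (Measurable.lintegral_prod_left hprod), lintegral_lintegral_mul_self hprod]
  refine lintegral_congr fun γ => lintegral_congr fun γ' => ?_
  simp_rw [← Finset.prod_mul_distrib]
  rw [iidSamples, lintegral_fintype_prod_eq_prod fun _ => hmul γ γ',
    Finset.prod_const, Finset.card_univ, Fintype.card_fin]

end SecondMoment

section ScaleMixture

variable {κ ι : Type*} [Fintype κ] [Fintype ι] [DecidableEq ι]

/-- The mixture `∑ₖ wₖ N(0, I + sₖ A)` of centred Gaussians, with weights `w` and scales `s`. -/
def scaleMixture (w s : κ → ℝ) (A : Matrix ι ι ℝ) : Measure (EuclideanSpace ℝ ι) :=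
  ∑ k, ENNReal.ofReal (w k) • multivariateGaussian 0 (1 + s k • A)

/-- The density of `scaleMixture w s A` with respect to the standard Gaussian. -/
def mixtureDensity (w s : κ → ℝ) (A : Matrix ι ι ℝ) (x : EuclideanSpace ℝ ι) : ℝ≥0∞ :=
  ∑ k, ENNReal.ofReal (w k) * gaussianTilt (1 + s k • A) x

variable {w : κ → ℝ}

lemma isProbabilityMeasure_scaleMixture (hw : ∀ k, 0 ≤ w k) (hw1 : ∑ k, w k = 1) (s : κ → ℝ)
    (A : Matrix ι ι ℝ) : IsProbabilityMeasure (scaleMixture w s A) := by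
  constructor
  simp only [scaleMixture, Measure.finsetSum_apply, Measure.smul_apply, measure_univ, smul_eq_mul,
    mul_one]
  rw [← ENNReal.ofReal_sum_of_nonneg fun k _ => hw k, hw1, ENNReal.ofReal_one]

lemma measurable_uncurry_mixtureDensity (w s : κ → ℝ) {Γ : Type*} [MeasurableSpace Γ]
    {S : Γ → Matrix ι ι ℝ} (hS : ∀ i j, Measurable fun γ => S γ i j) :
    Measurable (Function.uncurry fun γ => mixtureDensity w s (S γ)) := by
  refine Finset.measurable_sum _ fun k _ => Measurable.const_mul ?_ _
  refine measurable_gaussianTilt_comp (S := fun γ => 1 + s k • S γ) fun i j => ?_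
  exact ((hS i j).const_mul (s k)).const_add _

variable {s : κ → ℝ} {A B : Matrix ι ι ℝ}

lemma scaleMixture_eq_withDensity (hA : A.IsHermitian) (hsA : ∀ k, ‖s k • A‖ < 1) :
    scaleMixture w s A =
      (stdGaussian (EuclideanSpace ℝ ι)).withDensity (mixtureDensity w s A) := by
  ext t ht
  have htilt (k : κ) : Measurable (gaussianTilt (1 + s k • A)) := measurable_gaussianTilt _
  simp only [scaleMixture, Measure.finsetSum_apply, Measure.smul_apply, smul_eq_mul,
    withDensity_apply _ ht, mixtureDensity]
  rw [lintegral_finsetSum _ fun k _ => (htilt k).const_mul _]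
  refine Finset.sum_congr rfl fun k _ => ?_
  rw [multivariateGaussian_zero_eq_withDensity
    (posDef_one_add_of_l2_opNorm_lt_one (hA.smul (IsSelfAdjoint.all (s k))) (hsA k)),
    withDensity_apply _ ht, lintegral_const_mul _ (htilt k)]

lemma lintegral_mixtureDensity_mul (hw : ∀ k, 0 ≤ w k) (hA : A.IsHermitian) (hB : B.IsHermitian)
    (hsA : ∀ k, ‖s k • A‖ < 1) (hsB : ∀ k, ‖s k • B‖ < 1) :
    ∫⁻ x, mixtureDensity w s A x * mixtureDensity w s B x ∂(stdGaussian (EuclideanSpace ℝ ι)) =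
      ENNReal.ofReal (mixtureKernel w s (A * B)) := by
  have htilt (S T : Matrix ι ι ℝ) : Measurable fun x => gaussianTilt S x * gaussianTilt T x :=
    (measurable_gaussianTilt S).mul (measurable_gaussianTilt T)
  simp_rw [mixtureDensity, Finset.sum_mul_sum, ← Fintype.sum_prod_type',
    mul_mul_mul_comm (ENNReal.ofReal (w _))]
  rw [lintegral_finsetSum _ fun q _ => (htilt _ _).const_mul _, mixtureKernel,
    ENNReal.ofReal_sum_of_nonneg fun q _ => mul_nonneg (mul_nonneg (hw _) (hw _)) (by positivity)]
  refine Finset.sum_congr rfl fun q _ => ?_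
  rw [lintegral_const_mul _ (htilt _ _), lintegral_gaussianTilt_mul_gaussianTilt
    (hA.smul (IsSelfAdjoint.all _)) (hB.smul (IsSelfAdjoint.all _)) (hsA _) (hsB _),
    smul_mul_smul_comm, ENNReal.ofReal_mul (mul_nonneg (hw _) (hw _)), ENNReal.ofReal_mul (hw _)]

end ScaleMixture

section SymmetricGaussianMatrix

/-- The index type of the entries above the diagonal. -/
abbrev UpperPairs (d : ℕ) : Type := {p : Fin d × Fin d // p.1 < p.2}

variable {d : ℕ}

lemma card_upperPairs_le (d : ℕ) : Fintype.card (UpperPairs d) ≤ d ^ 2 := by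
  simpa [sq] using Fintype.card_subtype_le fun p : Fin d × Fin d => p.1 < p.2

lemma sum_upperPairs_eq_sum_ite (f : Fin d → Fin d → ℝ) :
    ∑ p : UpperPairs d, f p.1.1 p.1.2 = ∑ i, ∑ j, if i < j then f i j else 0 := by
  rw [← Fintype.sum_prod_type' (f := fun i j => if i < j then f i j else 0), ← Finset.sum_filter]
  exact (Finset.sum_subtype _ (by simp) fun q : Fin d × Fin d => f q.1 q.2).symm

lemma sum_upperPairs_le {f : Fin d → Fin d → ℝ} (hf : ∀ i j, 0 ≤ f i j) :
    ∑ p : UpperPairs d, f p.1.1 p.1.2 ≤ ∑ i, ∑ j, f i j := by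
  rw [sum_upperPairs_eq_sum_ite]
  gcongr with i _ j _
  split_ifs
  exacts [le_rfl, hf i j]

lemma sum_sum_eq_sum_upperPairs {f : Fin d → Fin d → ℝ} (hf : ∀ i, f i i = 0) :
    ∑ i, ∑ j, f i j = ∑ p : UpperPairs d, (f p.1.1 p.1.2 + f p.1.2 p.1.1) := by
  have hsplit (i j : Fin d) :
      f i j = (if i < j then f i j else 0) + if j < i then f i j else 0 := by
    rcases lt_trichotomy i j with h | rfl | h
    · simp [h, h.not_gt]
    · simp [hf]
    · simp [h, h.not_gt]
  rw [Finset.sum_add_distrib, sum_upperPairs_eq_sum_ite, sum_upperPairs_eq_sum_ite fun i j => f j i,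
    Finset.sum_comm (f := fun i j => if i < j then f j i else 0), ← Finset.sum_add_distrib]
  simp_rw [← Finset.sum_add_distrib, ← hsplit]

lemma symMatrix_apply_upperPair (g : UpperPairs d → ℝ) (p : UpperPairs d) :
    symMatrix g p.1.1 p.1.2 = g p := by
  simp [symMatrix, p.2]

lemma symMatrix_apply_self (g : UpperPairs d → ℝ) (i : Fin d) : symMatrix g i i = 0 := by
  simp [symMatrix]

lemma symMatrix_apply_comm (g : UpperPairs d → ℝ) (i j : Fin d) :
    symMatrix g i j = symMatrix g j i := by
  rcases lt_trichotomy i j with h | rfl | h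
  · simp [symMatrix, h, h.not_gt]
  · rfl
  · simp [symMatrix, h, h.not_gt]

lemma isHermitian_symMatrix (g : UpperPairs d → ℝ) : (symMatrix g).IsHermitian := by
  ext i j
  exact symMatrix_apply_comm g j i

lemma continuous_symMatrix : Continuous (symMatrix (d := d)) := by
  refine continuous_matrix fun i j => ?_
  simp only [symMatrix, Matrix.of_apply]
  split_ifs <;> fun_prop

lemma measurable_symMatrix_apply (i j : Fin d) :
    Measurable fun g : UpperPairs d → ℝ => symMatrix g i j :=
  (continuous_symMatrix.matrix_elem i j).measurable

lemma sum_symMatrix_mul (g : UpperPairs d → ℝ) (h : Fin d → Fin d → ℝ) :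
    ∑ i, ∑ j, symMatrix g i j * h i j =
      ∑ p : UpperPairs d, g p * (h p.1.1 p.1.2 + h p.1.2 p.1.1) := by
  rw [sum_sum_eq_sum_upperPairs fun i => by rw [symMatrix_apply_self, zero_mul]]
  refine Finset.sum_congr rfl fun p _ => ?_
  rw [symMatrix_apply_comm g p.1.2, symMatrix_apply_upperPair, mul_add]

lemma trace_symMatrix_mul (g h : UpperPairs d → ℝ) :
    (symMatrix g * symMatrix h).trace = 2 * ∑ p, g p * h p := by
  have htrace : (symMatrix g * symMatrix h).trace =
      ∑ i, ∑ j, symMatrix g i j * symMatrix h i j := by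
    simp only [trace, diag, mul_apply, symMatrix_apply_comm h]
  rw [htrace, sum_symMatrix_mul g fun i j => symMatrix h i j, Finset.mul_sum]
  refine Finset.sum_congr rfl fun p _ => ?_
  rw [symMatrix_apply_comm h p.1.2, symMatrix_apply_upperPair]
  ring

lemma sum_sq_symMatrix (g : UpperPairs d → ℝ) :
    ∑ i, ∑ j, symMatrix g i j ^ 2 = 2 * ∑ p, g p ^ 2 := by
  rw [sum_sum_eq_sum_upperPairs fun i => by rw [symMatrix_apply_self]; norm_num, Finset.mul_sum]
  refine Finset.sum_congr rfl fun p _ => ?_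
  rw [symMatrix_apply_comm g p.1.2, symMatrix_apply_upperPair, two_mul]

lemma mul_symMatrix_mul_apply (B C : Matrix (Fin d) (Fin d) ℝ) (g : UpperPairs d → ℝ)
    (i j : Fin d) :
    (B * symMatrix g * C) i j =
      ∑ q : UpperPairs d, g q * (B i q.1.1 * C q.1.2 j + B i q.1.2 * C q.1.1 j) := by
  rw [← sum_symMatrix_mul g fun k l => B i k * C l j, Finset.sum_comm, mul_apply]
  simp only [mul_apply, Finset.sum_mul]
  exact Finset.sum_congr rfl fun l _ => Finset.sum_congr rfl fun k _ => by ring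

lemma trace_symMatrix_mul_sq (g h : UpperPairs d → ℝ) :
    ((symMatrix g * symMatrix h) ^ 2).trace =
      2 * ∑ p : UpperPairs d, ∑ q : UpperPairs d, g p * g q *
        (symMatrix h p.1.1 q.1.1 * symMatrix h p.1.2 q.1.2 +
          symMatrix h p.1.1 q.1.2 * symMatrix h p.1.2 q.1.1) := by
  have htrace : ((symMatrix g * symMatrix h) ^ 2).trace =
      ∑ i, ∑ j, symMatrix g i j * (symMatrix h * symMatrix g * symMatrix h) j i := by
    rw [sq, Matrix.mul_assoc, ← Matrix.mul_assoc (symMatrix h)]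
    simp only [trace, diag, mul_apply (M := symMatrix g)]
  rw [htrace, sum_symMatrix_mul g fun i j => (symMatrix h * symMatrix g * symMatrix h) j i,
    Finset.mul_sum]
  refine Finset.sum_congr rfl fun p _ => ?_
  rw [mul_symMatrix_mul_apply, mul_symMatrix_mul_apply, ← Finset.sum_add_distrib, Finset.mul_sum,
    Finset.mul_sum]
  refine Finset.sum_congr rfl fun q _ => ?_
  rw [symMatrix_apply_comm h q.1.1, symMatrix_apply_comm h q.1.2,
    symMatrix_apply_comm h q.1.1, symMatrix_apply_comm h q.1.2]
  ring

lemma dotProduct_symMatrix_mulVec (g : UpperPairs d → ℝ) (v : Fin d → ℝ) :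
    v ⬝ᵥ symMatrix g *ᵥ v = ∑ p : UpperPairs d, 2 * (v p.1.1 * v p.1.2) * g p := by
  have hsum : v ⬝ᵥ symMatrix g *ᵥ v = ∑ i, ∑ j, symMatrix g i j * (v i * v j) := by
    simp only [dotProduct, mulVec, Finset.mul_sum]
    exact Finset.sum_congr rfl fun i _ => Finset.sum_congr rfl fun j _ => by ring
  rw [hsum, sum_symMatrix_mul g fun i j => v i * v j]
  exact Finset.sum_congr rfl fun p _ => by ring

instance isProbabilityMeasure_entryLaw : IsProbabilityMeasure (entryLaw d) := by
  unfold entryLaw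
  infer_instance

lemma entryLaw_eq_map (d : ℕ) : entryLaw d =
    (stdGaussian (EuclideanSpace ℝ (UpperPairs d))).map fun x => (d : ℝ)⁻¹ • x.ofLp := by
  have hentry : gaussianReal 0 (1 / (d : ℝ≥0) ^ 2) =
      (gaussianReal 0 1).map (fun x => (d : ℝ)⁻¹ * x) := by
    rw [gaussianReal_map_const_mul, mul_zero]
    congr 1
    ext
    simp
  rw [← map_pi_eq_stdGaussian, Measure.map_map (by fun_prop) (by fun_prop), entryLaw, hentry,
    ← Measure.pi_map_pi (fun _ => by fun_prop)]
  rfl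

lemma lintegral_entryLaw {f : (UpperPairs d → ℝ) → ℝ≥0∞} (hf : Measurable f) :
    ∫⁻ g, f g ∂(entryLaw d) =
      ∫⁻ x, f ((d : ℝ)⁻¹ • x.ofLp) ∂(stdGaussian (EuclideanSpace ℝ (UpperPairs d))) := by
  rw [entryLaw_eq_map, lintegral_map hf (by fun_prop)]

lemma lintegral_entryLaw_exp_quadraticForm_le (hd : d ≠ 0)
    {K : Matrix (UpperPairs d) (UpperPairs d) ℝ} (hK : K.IsHermitian)
    (h : ∑ p, ∑ q, K p q ^ 2 ≤ 1 / 16) :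
    ∫⁻ g, ENNReal.ofReal (Real.exp (d ^ 2 * (g ⬝ᵥ K *ᵥ g))) ∂(entryLaw d) ≤
      ENNReal.ofReal (Real.exp (K.trace + 4 * ∑ p, ∑ q, K p q ^ 2)) := by
  have hscale (x : UpperPairs d → ℝ) :
      (d : ℝ) ^ 2 * ((d : ℝ)⁻¹ • x ⬝ᵥ K *ᵥ (d : ℝ)⁻¹ • x) = x ⬝ᵥ K *ᵥ x := by
    have hd' : (d : ℝ) ≠ 0 := by exact_mod_cast hd
    simp only [mulVec_smul, smul_dotProduct, dotProduct_smul, smul_eq_mul]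
    field_simp
  rw [lintegral_entryLaw (by simp only [dotProduct, mulVec]; fun_prop)]
  simp_rw [hscale]
  exact lintegral_exp_quadraticForm_le hK h

end SymmetricGaussianMatrix

section TraceForm

variable {d : ℕ}

/-- The matrix of the quadratic form `A ↦ L tr(AB)² + c tr((AB)²)` in the entries of `A` above the
diagonal, where `A` and `B = symMatrix h` are symmetric matrices with zero diagonal. -/
def traceForm (L c : ℝ) (h : UpperPairs d → ℝ) : Matrix (UpperPairs d) (UpperPairs d) ℝ :=
  Matrix.of fun p q => 4 * L * (symMatrix h p.1.1 p.1.2 * symMatrix h q.1.1 q.1.2) +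
    2 * c * (symMatrix h p.1.1 q.1.1 * symMatrix h p.1.2 q.1.2 +
      symMatrix h p.1.1 q.1.2 * symMatrix h p.1.2 q.1.1)

lemma isHermitian_traceForm (L c : ℝ) (h : UpperPairs d → ℝ) : (traceForm L c h).IsHermitian := by
  ext p q
  simp only [traceForm, conjTranspose_apply, Matrix.of_apply, star_trivial]
  rw [symMatrix_apply_comm h q.1.1 p.1.1, symMatrix_apply_comm h q.1.2 p.1.2,
    symMatrix_apply_comm h q.1.1 p.1.2, symMatrix_apply_comm h q.1.2 p.1.1]
  ring

lemma dotProduct_traceForm_mulVec (L c : ℝ) (g h : UpperPairs d → ℝ) :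
    g ⬝ᵥ traceForm L c h *ᵥ g = L * (symMatrix g * symMatrix h).trace ^ 2 +
      c * ((symMatrix g * symMatrix h) ^ 2).trace := by
  rw [trace_symMatrix_mul, trace_symMatrix_mul_sq, mul_pow, sq (∑ p, g p * h p),
    Finset.sum_mul_sum]
  simp only [dotProduct, mulVec, traceForm, Matrix.of_apply, symMatrix_apply_upperPair,
    Finset.mul_sum, ← Finset.sum_add_distrib]
  exact Finset.sum_congr rfl fun p _ => Finset.sum_congr rfl fun q _ => by ring

lemma trace_traceForm_le {L c : ℝ} (hL : 0 ≤ L) (hc : 0 ≤ c) (h : UpperPairs d → ℝ) :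
    (traceForm L c h).trace ≤ (4 * L + 2 * c) * ∑ i, ∑ j, symMatrix h i j ^ 2 := by
  calc (traceForm L c h).trace
      = (4 * L + 2 * c) * ∑ p : UpperPairs d, symMatrix h p.1.1 p.1.2 ^ 2 := by
        rw [Finset.mul_sum]
        simp only [trace, diag, traceForm, Matrix.of_apply]
        refine Finset.sum_congr rfl fun p _ => ?_
        rw [symMatrix_apply_self, symMatrix_apply_comm h p.1.2 p.1.1]
        ring
    _ ≤ (4 * L + 2 * c) * ∑ i, ∑ j, symMatrix h i j ^ 2 := by
        gcongr
        exact sum_upperPairs_le (f := fun i j => symMatrix h i j ^ 2) fun i j => sq_nonneg _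

lemma sum_upperPairs_sum_upperPairs_le {f : Fin d → Fin d → Fin d → Fin d → ℝ}
    (hf : ∀ i j k l, 0 ≤ f i j k l) :
    ∑ p : UpperPairs d, ∑ q : UpperPairs d, f p.1.1 p.1.2 q.1.1 q.1.2 ≤
      ∑ i, ∑ j, ∑ k, ∑ l, f i j k l := by
  calc ∑ p : UpperPairs d, ∑ q : UpperPairs d, f p.1.1 p.1.2 q.1.1 q.1.2
      ≤ ∑ p : UpperPairs d, ∑ k, ∑ l, f p.1.1 p.1.2 k l := by
        gcongr with p
        exact sum_upperPairs_le (hf p.1.1 p.1.2)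
    _ ≤ ∑ i, ∑ j, ∑ k, ∑ l, f i j k l :=
        sum_upperPairs_le (f := fun i j => ∑ k, ∑ l, f i j k l) fun i j =>
          Finset.sum_nonneg fun k _ => Finset.sum_nonneg fun l _ => hf i j k l

lemma add_add_sq_le (x y z : ℝ) : (x + y + z) ^ 2 ≤ 3 * (x ^ 2 + y ^ 2 + z ^ 2) := by
  nlinarith [sq_nonneg (x - y), sq_nonneg (y - z), sq_nonneg (x - z)]

lemma sum_sq_pairings_le {n : Type*} [Fintype n] (a b c : ℝ) (B : Matrix n n ℝ) :
    ∑ i, ∑ j, ∑ k, ∑ l,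
        (a * (B i j * B k l) + b * (B i k * B j l) + c * (B i l * B j k)) ^ 2 ≤
      3 * (a ^ 2 + b ^ 2 + c ^ 2) * (∑ i, ∑ j, B i j ^ 2) ^ 2 := by
  have h₁ : ∑ i, ∑ j, ∑ k, ∑ l, B i j ^ 2 * B k l ^ 2 = (∑ i, ∑ j, B i j ^ 2) ^ 2 := by
    simp only [← Finset.mul_sum, ← Finset.sum_mul, sq (∑ i, ∑ j, B i j ^ 2)]
  have h₂ : ∑ i, ∑ j, ∑ k, ∑ l, B i k ^ 2 * B j l ^ 2 = (∑ i, ∑ j, B i j ^ 2) ^ 2 := by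
    simp only [← Finset.mul_sum, ← Finset.sum_mul, sq (∑ i, ∑ j, B i j ^ 2)]
  have h₃ : ∑ i, ∑ j, ∑ k, ∑ l, B i l ^ 2 * B j k ^ 2 = (∑ i, ∑ j, B i j ^ 2) ^ 2 := by
    rw [← h₂]
    exact Finset.sum_congr rfl fun i _ => Finset.sum_congr rfl fun j _ => Finset.sum_comm
  calc ∑ i, ∑ j, ∑ k, ∑ l, (a * (B i j * B k l) + b * (B i k * B j l) + c * (B i l * B j k)) ^ 2
      ≤ ∑ i, ∑ j, ∑ k, ∑ l, (3 * a ^ 2 * (B i j ^ 2 * B k l ^ 2) +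
          3 * b ^ 2 * (B i k ^ 2 * B j l ^ 2) + 3 * c ^ 2 * (B i l ^ 2 * B j k ^ 2)) := by
        gcongr
        exact (add_add_sq_le _ _ _).trans_eq (by ring)
    _ = 3 * (a ^ 2 + b ^ 2 + c ^ 2) * (∑ i, ∑ j, B i j ^ 2) ^ 2 := by
        simp only [Finset.sum_add_distrib, ← Finset.mul_sum] at h₁ h₂ h₃ ⊢
        rw [h₁, h₂, h₃]
        ring

lemma sum_sq_traceForm_le (L c : ℝ) (h : UpperPairs d → ℝ) :
    ∑ p, ∑ q, traceForm L c h p q ^ 2 ≤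
      (48 * L ^ 2 + 24 * c ^ 2) * (∑ i, ∑ j, symMatrix h i j ^ 2) ^ 2 := by
  have hentry (p q : UpperPairs d) : traceForm L c h p q =
      4 * L * (symMatrix h p.1.1 p.1.2 * symMatrix h q.1.1 q.1.2) +
        2 * c * (symMatrix h p.1.1 q.1.1 * symMatrix h p.1.2 q.1.2) +
        2 * c * (symMatrix h p.1.1 q.1.2 * symMatrix h p.1.2 q.1.1) := by
    simp only [traceForm, Matrix.of_apply]
    ring
  simp_rw [hentry]
  refine (sum_upperPairs_sum_upperPairs_le (f := fun i j k l =>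
    (4 * L * (symMatrix h i j * symMatrix h k l) + 2 * c * (symMatrix h i k * symMatrix h j l) +
      2 * c * (symMatrix h i l * symMatrix h j k)) ^ 2) fun _ _ _ _ => sq_nonneg _).trans ?_
  exact (sum_sq_pairings_le _ _ _ _).trans_eq (by ring)

lemma lintegral_entryLaw_exp_traceForm_le {L c ε F : ℝ} (hL : 0 ≤ L) (hc : 0 ≤ c) (hε : 0 ≤ ε)
    (hd : d ≠ 0) {h : UpperPairs d → ℝ} (hF : ∑ i, ∑ j, symMatrix h i j ^ 2 ≤ F)
    (hsmall : ε ^ 2 * ((48 * L ^ 2 + 24 * c ^ 2) * F ^ 2) ≤ 1 / 16) :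
    ∫⁻ g, ENNReal.ofReal (Real.exp (ε * d ^ 2 * (L * (symMatrix g * symMatrix h).trace ^ 2 +
        c * ((symMatrix g * symMatrix h) ^ 2).trace))) ∂(entryLaw d) ≤
      ENNReal.ofReal (Real.exp (ε * ((4 * L + 2 * c) * F) +
        4 * (ε ^ 2 * ((48 * L ^ 2 + 24 * c ^ 2) * F ^ 2)))) := by
  have hsq : ∑ p, ∑ q, (ε • traceForm L c h) p q ^ 2 ≤
      ε ^ 2 * ((48 * L ^ 2 + 24 * c ^ 2) * F ^ 2) := by
    simp only [Matrix.smul_apply, smul_eq_mul, mul_pow, ← Finset.mul_sum]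
    gcongr
    exact (sum_sq_traceForm_le L c h).trans (by gcongr)
  have htrace : (ε • traceForm L c h).trace ≤ ε * ((4 * L + 2 * c) * F) := by
    rw [trace_smul, smul_eq_mul]
    gcongr
    exact (trace_traceForm_le hL hc h).trans (by gcongr)
  have hform (g : UpperPairs d → ℝ) :
      ε * d ^ 2 * (L * (symMatrix g * symMatrix h).trace ^ 2 +
        c * ((symMatrix g * symMatrix h) ^ 2).trace) =
      d ^ 2 * (g ⬝ᵥ (ε • traceForm L c h) *ᵥ g) := by
    rw [← dotProduct_traceForm_mulVec, smul_mulVec, dotProduct_smul, smul_eq_mul]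
    ring
  simp_rw [hform]
  refine (lintegral_entryLaw_exp_quadraticForm_le hd
    ((isHermitian_traceForm L c h).smul (IsSelfAdjoint.all ε)) (hsq.trans hsmall)).trans ?_
  gcongr

end TraceForm

section QuadraticFormNet

variable {E : Type*} [NormedAddCommGroup E] [InnerProductSpace ℝ E]

lemma exists_half_norm_le_abs_inner {T : E →L[ℝ] E} (hT : (T : E →ₗ[ℝ] E).IsSymmetric) :
    ∃ u : E, ‖u‖ ≤ 1 ∧ ‖T‖ / 2 ≤ |inner ℝ u (T u)| := by
  rcases (norm_nonneg T).eq_or_lt with hzero | hpos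
  · exact ⟨0, by simp, by simp [← hzero]⟩
  have hlt : ‖T‖ / 2 < ⨆ x, |T.rayleighQuotient x| := by
    rw [← T.norm_eq_iSup_rayleighQuotient hT]
    linarith
  obtain ⟨x, hx⟩ := exists_lt_of_lt_ciSup hlt
  have hx0 : x ≠ 0 := by
    rintro rfl
    rw [T.rayleighQuotient_apply_zero, abs_zero] at hx
    linarith
  have hunit : ‖‖x‖⁻¹ • x‖ = 1 := by
    rw [norm_smul, norm_inv, norm_norm, inv_mul_cancel₀ (norm_ne_zero_iff.2 hx0)]
  refine ⟨‖x‖⁻¹ • x, hunit.le, ?_⟩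
  rw [← T.rayleigh_smul x (inv_ne_zero (norm_ne_zero_iff.2 hx0)),
    ContinuousLinearMap.rayleighQuotient.eq_def, hunit, one_pow, div_one,
    ContinuousLinearMap.reApplyInnerSelf_apply, real_inner_comm] at hx
  exact hx.le

lemma abs_inner_sub_inner_le (T : E →L[ℝ] E) (u v : E) :
    |inner ℝ u (T u) - inner ℝ v (T v)| ≤ ‖u - v‖ * (‖u‖ + ‖v‖) * ‖T‖ := by
  calc |inner ℝ u (T u) - inner ℝ v (T v)|
      = |inner ℝ (u - v) (T u) + inner ℝ v (T (u - v))| := by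
        rw [map_sub, inner_sub_left, inner_sub_right]
        ring_nf
    _ ≤ ‖u - v‖ * (‖T‖ * ‖u‖) + ‖v‖ * (‖T‖ * ‖u - v‖) :=
        (abs_add_le _ _).trans (add_le_add
          ((abs_real_inner_le_norm _ _).trans (by gcongr; exact T.le_opNorm u))
          ((abs_real_inner_le_norm _ _).trans (by gcongr; exact T.le_opNorm _)))
    _ = ‖u - v‖ * (‖u‖ + ‖v‖) * ‖T‖ := by ring

lemma exists_ball_subset_le_abs_inner {T : E →L[ℝ] E} (hT : (T : E →ₗ[ℝ] E).IsSymmetric) :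
    ∃ u : E, Metric.ball u (1 / 8) ⊆ Metric.ball 0 (9 / 8) ∧
      ∀ v ∈ Metric.ball u (1 / 8), 15 / 64 * ‖T‖ ≤ |inner ℝ v (T v)| := by
  obtain ⟨u, hu, hTu⟩ := exists_half_norm_le_abs_inner hT
  have hsub : Metric.ball u (1 / 8) ⊆ Metric.ball 0 (9 / 8) :=
    Metric.ball_subset_ball' (by rw [dist_zero_right]; linarith)
  refine ⟨u, hsub, fun v hv => ?_⟩
  have hv_norm : ‖v‖ ≤ 9 / 8 := (mem_ball_zero_iff.1 (hsub hv)).le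
  have hdist : ‖u - v‖ ≤ 1 / 8 := (mem_ball_iff_norm'.1 hv).le
  have hchange : |inner ℝ u (T u) - inner ℝ v (T v)| ≤ 1 / 8 * (1 + 9 / 8) * ‖T‖ :=
    (abs_inner_sub_inner_le T u v).trans (by gcongr)
  linarith [abs_sub_abs_le_abs_sub (inner ℝ u (T u)) (inner ℝ v (T v))]

lemma exp_mul_norm_mul_measure_ball_le [MeasurableSpace E] [BorelSpace E]
    (μ : Measure E) [μ.IsAddHaarMeasure] {T : E →L[ℝ] E}
    (hT : (T : E →ₗ[ℝ] E).IsSymmetric) {t : ℝ} (ht : 0 ≤ t) :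
    ENNReal.ofReal (Real.exp (15 / 64 * t * ‖T‖)) * μ (Metric.ball 0 (1 / 8)) ≤
      ∫⁻ v in Metric.ball 0 (9 / 8), (ENNReal.ofReal (Real.exp (t * inner ℝ v (T v))) +
        ENNReal.ofReal (Real.exp (-t * inner ℝ v (T v)))) ∂μ := by
  obtain ⟨u, hsub, hu⟩ := exists_ball_subset_le_abs_inner hT
  have hexp (v : E) (hv : v ∈ Metric.ball u (1 / 8)) :
      ENNReal.ofReal (Real.exp (15 / 64 * t * ‖T‖)) ≤
        ENNReal.ofReal (Real.exp (t * inner ℝ v (T v))) +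
          ENNReal.ofReal (Real.exp (-t * inner ℝ v (T v))) := by
    rw [← ENNReal.ofReal_add (Real.exp_pos _).le (Real.exp_pos _).le, neg_mul]
    refine ENNReal.ofReal_le_ofReal (le_trans ?_ (Real.exp_abs_le _))
    rw [Real.exp_le_exp, abs_mul, abs_of_nonneg ht, mul_comm (15 / 64) t, mul_assoc]
    exact mul_le_mul_of_nonneg_left (hu v hv) ht
  calc ENNReal.ofReal (Real.exp (15 / 64 * t * ‖T‖)) * μ (Metric.ball 0 (1 / 8))
      = ∫⁻ _ in Metric.ball u (1 / 8), ENNReal.ofReal (Real.exp (15 / 64 * t * ‖T‖)) ∂μ := by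
        rw [setLIntegral_const, Measure.addHaar_ball_center μ u]
    _ ≤ ∫⁻ v in Metric.ball u (1 / 8), (ENNReal.ofReal (Real.exp (t * inner ℝ v (T v))) +
          ENNReal.ofReal (Real.exp (-t * inner ℝ v (T v)))) ∂μ :=
        setLIntegral_mono' measurableSet_ball hexp
    _ ≤ _ := lintegral_mono_set hsub

end QuadraticFormNet

section NormTails

variable {d : ℕ}

lemma measure_lt_le_of_lintegral_exp_le {Ω : Type*} [MeasurableSpace Ω] {μ : Measure Ω}
    {f : Ω → ℝ} (hf : Measurable f) {M : ℝ}
    (h : ∫⁻ ω, ENNReal.ofReal (Real.exp (f ω)) ∂μ ≤ ENNReal.ofReal M) (a : ℝ) :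
    μ {ω | a < f ω} ≤ ENNReal.ofReal (Real.exp (-a) * M) := by
  have hmarkov := meas_ge_le_lintegral_div (μ := μ) (f := fun ω => ENNReal.ofReal (Real.exp (f ω)))
    (by fun_prop) (ENNReal.ofReal_pos.2 (Real.exp_pos a)).ne' ENNReal.ofReal_ne_top
  calc μ {ω | a < f ω}
      ≤ μ {ω | ENNReal.ofReal (Real.exp a) ≤ ENNReal.ofReal (Real.exp (f ω))} :=
        measure_mono fun ω hω => ENNReal.ofReal_le_ofReal (Real.exp_le_exp.2 (le_of_lt hω))
    _ ≤ ENNReal.ofReal M / ENNReal.ofReal (Real.exp a) := hmarkov.trans (by gcongr)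
    _ = ENNReal.ofReal (Real.exp (-a) * M) := by
        rw [← ENNReal.ofReal_div_of_pos (Real.exp_pos a), Real.exp_neg, div_eq_inv_mul]

lemma lintegral_exp_mul_gaussianReal (v : ℝ≥0) (c : ℝ) :
    ∫⁻ x, ENNReal.ofReal (Real.exp (c * x)) ∂(gaussianReal 0 v) =
      ENNReal.ofReal (Real.exp (v * c ^ 2 / 2)) := by
  have hmgf := congrFun (mgf_fun_id_gaussianReal (μ := 0) (v := v)) c
  rw [mgf, zero_mul, zero_add] at hmgf
  rw [← ofReal_integral_eq_lintegral_ofReal (integrable_exp_mul_gaussianReal c)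
    (ae_of_all _ fun _ => (Real.exp_pos _).le), hmgf]

lemma lintegral_entryLaw_exp_linear (c : UpperPairs d → ℝ) :
    ∫⁻ g, ENNReal.ofReal (Real.exp (∑ p, c p * g p)) ∂(entryLaw d) =
      ENNReal.ofReal (Real.exp ((∑ p, c p ^ 2) / (2 * d ^ 2))) := by
  simp_rw [Real.exp_sum, ENNReal.ofReal_prod_of_nonneg fun _ _ => (Real.exp_pos _).le]
  rw [entryLaw, lintegral_fintype_prod_eq_prod
    (f := fun p x => ENNReal.ofReal (Real.exp (c p * x))) fun _ => by fun_prop]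
  simp_rw [lintegral_exp_mul_gaussianReal]
  rw [← ENNReal.ofReal_prod_of_nonneg fun _ _ => (Real.exp_pos _).le, ← Real.exp_sum,
    Finset.sum_div]
  congr 2
  refine Finset.sum_congr rfl fun p _ => ?_
  push_cast
  rw [mul_comm (2 : ℝ), ← div_div]
  ring

lemma sum_sq_mul_eq_norm_pow_four (v : EuclideanSpace ℝ (Fin d)) :
    ∑ i, ∑ j, (v i * v j) ^ 2 = ‖v‖ ^ 4 := by
  calc ∑ i, ∑ j, (v i * v j) ^ 2 = (∑ i, v i ^ 2) * ∑ j, v j ^ 2 := by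
        simp_rw [mul_pow, Finset.sum_mul_sum]
    _ = ‖v‖ ^ 4 := by
        rw [← EuclideanSpace.real_norm_sq_eq]
        ring

lemma lintegral_entryLaw_exp_dotProduct_le (t : ℝ) (v : EuclideanSpace ℝ (Fin d)) :
    ∫⁻ g, ENNReal.ofReal (Real.exp (t * (v.ofLp ⬝ᵥ symMatrix g *ᵥ v.ofLp))) ∂(entryLaw d) ≤
      ENNReal.ofReal (Real.exp (2 * t ^ 2 * ‖v‖ ^ 4 / d ^ 2)) := by
  have hlinear (g : UpperPairs d → ℝ) : t * (v.ofLp ⬝ᵥ symMatrix g *ᵥ v.ofLp) =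
      ∑ p : UpperPairs d, 2 * t * (v p.1.1 * v p.1.2) * g p := by
    rw [dotProduct_symMatrix_mulVec, Finset.mul_sum]
    exact Finset.sum_congr rfl fun p _ => by ring
  simp_rw [hlinear]
  rw [lintegral_entryLaw_exp_linear]
  refine ENNReal.ofReal_le_ofReal (Real.exp_le_exp.2 ?_)
  calc (∑ p : UpperPairs d, (2 * t * (v p.1.1 * v p.1.2)) ^ 2) / (2 * d ^ 2)
      = 4 * t ^ 2 * (∑ p : UpperPairs d, (v p.1.1 * v p.1.2) ^ 2) / (2 * d ^ 2) := by
        rw [Finset.mul_sum]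
        congr 1
        exact Finset.sum_congr rfl fun p _ => by ring
    _ ≤ 4 * t ^ 2 * ‖v‖ ^ 4 / (2 * d ^ 2) := by
        gcongr
        rw [← sum_sq_mul_eq_norm_pow_four]
        exact sum_upperPairs_le (f := fun i j => (v i * v j) ^ 2) fun i j => sq_nonneg _
    _ = 2 * t ^ 2 * ‖v‖ ^ 4 / d ^ 2 := by
        rw [← div_div]
        ring

lemma measurable_dotProduct_symMatrix : Measurable
    fun q : (UpperPairs d → ℝ) × EuclideanSpace ℝ (Fin d) =>
      q.2.ofLp ⬝ᵥ symMatrix q.1 *ᵥ q.2.ofLp := by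
  simp_rw [dotProduct_symMatrix_mulVec]
  fun_prop

lemma measurable_exp_mul_dotProduct_symMatrix (t : ℝ) : Measurable
    fun q : (UpperPairs d → ℝ) × EuclideanSpace ℝ (Fin d) =>
      ENNReal.ofReal (Real.exp (t * (q.2.ofLp ⬝ᵥ symMatrix q.1 *ᵥ q.2.ofLp))) :=
  (measurable_dotProduct_symMatrix.const_mul t).exp.ennreal_ofReal

lemma isSymmetric_toEuclideanCLM {A : Matrix (Fin d) (Fin d) ℝ} (hA : A.IsHermitian) :
    (toEuclideanCLM (n := Fin d) (𝕜 := ℝ) A : EuclideanSpace ℝ (Fin d) →ₗ[ℝ] _).IsSymmetric :=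
  (IsSelfAdjoint.map (x := A) hA (toEuclideanCLM (n := Fin d) (𝕜 := ℝ))).isSymmetric

lemma lintegral_entryLaw_exp_add_exp_neg_le (t : ℝ) {v : EuclideanSpace ℝ (Fin d)}
    (hv : ‖v‖ ≤ 9 / 8) :
    ∫⁻ g, (ENNReal.ofReal (Real.exp (t * (v.ofLp ⬝ᵥ symMatrix g *ᵥ v.ofLp))) +
        ENNReal.ofReal (Real.exp (-t * (v.ofLp ⬝ᵥ symMatrix g *ᵥ v.ofLp)))) ∂(entryLaw d) ≤
      ENNReal.ofReal (2 * Real.exp (4 * t ^ 2 / d ^ 2)) := by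
  have hexponent : 2 * t ^ 2 * ‖v‖ ^ 4 / d ^ 2 ≤ 4 * t ^ 2 / d ^ 2 := by
    have hv4 : ‖v‖ ^ 4 ≤ 2 := by
      calc ‖v‖ ^ 4 ≤ (9 / 8) ^ 4 := by gcongr
        _ ≤ 2 := by norm_num
    calc 2 * t ^ 2 * ‖v‖ ^ 4 / d ^ 2 ≤ 2 * t ^ 2 * 2 / d ^ 2 := by gcongr
      _ = 4 * t ^ 2 / d ^ 2 := by ring
  have hmeas : Measurable fun g : UpperPairs d → ℝ =>
      ENNReal.ofReal (Real.exp (t * (v.ofLp ⬝ᵥ symMatrix g *ᵥ v.ofLp))) := by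
    simp_rw [dotProduct_symMatrix_mulVec]
    fun_prop
  calc ∫⁻ g, (ENNReal.ofReal (Real.exp (t * (v.ofLp ⬝ᵥ symMatrix g *ᵥ v.ofLp))) +
        ENNReal.ofReal (Real.exp (-t * (v.ofLp ⬝ᵥ symMatrix g *ᵥ v.ofLp)))) ∂(entryLaw d)
      ≤ ENNReal.ofReal (Real.exp (2 * t ^ 2 * ‖v‖ ^ 4 / d ^ 2)) +
          ENNReal.ofReal (Real.exp (2 * (-t) ^ 2 * ‖v‖ ^ 4 / d ^ 2)) := by
        rw [lintegral_add_left hmeas]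
        exact add_le_add (lintegral_entryLaw_exp_dotProduct_le t v)
          (lintegral_entryLaw_exp_dotProduct_le (-t) v)
    _ = ENNReal.ofReal (2 * Real.exp (2 * t ^ 2 * ‖v‖ ^ 4 / d ^ 2)) := by
        rw [neg_sq, ← ENNReal.ofReal_add (Real.exp_pos _).le (Real.exp_pos _).le, ← two_mul]
    _ ≤ ENNReal.ofReal (2 * Real.exp (4 * t ^ 2 / d ^ 2)) := by gcongr

lemma lintegral_entryLaw_exp_l2_opNorm_le {t : ℝ} (ht : 0 ≤ t) :
    ∫⁻ g, ENNReal.ofReal (Real.exp (15 / 64 * t * ‖symMatrix g‖)) ∂(entryLaw d) ≤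
      ENNReal.ofReal (2 * Real.exp (4 * t ^ 2 / d ^ 2) * 9 ^ d) := by
  let f (g : UpperPairs d → ℝ) (v : EuclideanSpace ℝ (Fin d)) : ℝ≥0∞ :=
    ENNReal.ofReal (Real.exp (t * (v.ofLp ⬝ᵥ symMatrix g *ᵥ v.ofLp))) +
      ENNReal.ofReal (Real.exp (-t * (v.ofLp ⬝ᵥ symMatrix g *ᵥ v.ofLp)))
  have hf : Measurable (Function.uncurry f) :=
    (measurable_exp_mul_dotProduct_symMatrix t).add (measurable_exp_mul_dotProduct_symMatrix (-t))
  let β : ℝ≥0∞ := volume (Metric.ball (0 : EuclideanSpace ℝ (Fin d)) (1 / 8))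
  have hβ_pos : β ≠ 0 := (Metric.measure_ball_pos volume _ (by norm_num)).ne'
  have hβ_top : β ≠ ∞ := measure_ball_lt_top.ne
  have hvolume : volume (Metric.ball (0 : EuclideanSpace ℝ (Fin d)) (9 / 8)) =
      ENNReal.ofReal (9 ^ d) * β := by
    have := Measure.addHaar_ball_mul_of_pos volume (0 : EuclideanSpace ℝ (Fin d))
      (by norm_num : (0 : ℝ) < 9) (1 / 8)
    rwa [finrank_euclideanSpace_fin, mul_one_div] at this
  have hlower (g : UpperPairs d → ℝ) :
      ENNReal.ofReal (Real.exp (15 / 64 * t * ‖symMatrix g‖)) * β ≤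
        ∫⁻ v in Metric.ball 0 (9 / 8), f g v := by
    have := exp_mul_norm_mul_measure_ball_le volume
      (isSymmetric_toEuclideanCLM (isHermitian_symMatrix g)) ht
    simpa only [inner_toEuclideanCLM, l2_opNorm_toEuclideanCLM] using this
  refine (ENNReal.mul_le_mul_iff_left hβ_pos hβ_top).1 ?_
  calc (∫⁻ g, ENNReal.ofReal (Real.exp (15 / 64 * t * ‖symMatrix g‖)) ∂(entryLaw d)) * β
      ≤ ∫⁻ g, ∫⁻ v in Metric.ball 0 (9 / 8), f g v ∂volume ∂(entryLaw d) := by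
        rw [← lintegral_mul_const' _ _ hβ_top]
        exact lintegral_mono hlower
    _ = ∫⁻ v in Metric.ball 0 (9 / 8), ∫⁻ g, f g v ∂(entryLaw d) :=
        lintegral_lintegral_swap hf.aemeasurable
    _ ≤ ∫⁻ _ in Metric.ball (0 : EuclideanSpace ℝ (Fin d)) (9 / 8),
          ENNReal.ofReal (2 * Real.exp (4 * t ^ 2 / d ^ 2)) :=
        setLIntegral_mono' measurableSet_ball fun v hv =>
          lintegral_entryLaw_exp_add_exp_neg_le t (mem_ball_zero_iff.1 hv).le
    _ = ENNReal.ofReal (2 * Real.exp (4 * t ^ 2 / d ^ 2) * 9 ^ d) * β := by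
        rw [setLIntegral_const, hvolume, ← mul_assoc, ← ENNReal.ofReal_mul (by positivity)]

lemma nine_le_exp_three : (9 : ℝ) ≤ Real.exp 3 := by
  calc (9 : ℝ) ≤ 2.7 ^ 3 := by norm_num
    _ ≤ Real.exp 1 ^ 3 := by
        gcongr
        linarith [Real.exp_one_gt_d9]
    _ = Real.exp 3 := by
        rw [← Real.exp_nat_mul]
        norm_num

lemma continuous_l2_opNorm_symMatrix :
    Continuous fun g : UpperPairs d → ℝ => ‖symMatrix g‖ :=
  continuous_norm.comp continuous_symMatrix

lemma entryLaw_lt_matSpectralNorm_le (hd : d ≠ 0) {C : ℝ} (hC : 64 ≤ C) :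
    entryLaw d {g | C / √(d : ℝ) < matSpectralNorm (symMatrix g)} ≤
      ENNReal.ofReal (2 * Real.exp (-(8 * d))) := by
  have hd' : (0 : ℝ) < d := by positivity
  let t : ℝ := d * √d
  have ht : 4 * t ^ 2 / d ^ 2 = 4 * (d : ℝ) := by
    rw [mul_pow, Real.sq_sqrt hd'.le]
    field_simp
  have hsub : {g : UpperPairs d → ℝ | C / √(d : ℝ) < matSpectralNorm (symMatrix g)} ⊆
      {g | 15 * (d : ℝ) < 15 / 64 * t * ‖symMatrix g‖} := by
    intro g hg
    calc 15 * (d : ℝ) = 15 / 64 * t * (64 / √d) := by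
          simp only [t]
          field_simp
      _ ≤ 15 / 64 * t * (C / √d) := by gcongr
      _ < 15 / 64 * t * ‖symMatrix g‖ := mul_lt_mul_of_pos_left hg (by positivity)
  calc entryLaw d {g | C / √(d : ℝ) < matSpectralNorm (symMatrix g)}
      ≤ ENNReal.ofReal (Real.exp (-(15 * d)) * (2 * Real.exp (4 * t ^ 2 / d ^ 2) * 9 ^ d)) :=
        (measure_mono hsub).trans (measure_lt_le_of_lintegral_exp_le
          (continuous_l2_opNorm_symMatrix.measurable.const_mul _)
          (lintegral_entryLaw_exp_l2_opNorm_le (by positivity)) _)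
    _ ≤ ENNReal.ofReal (Real.exp (-(15 * d)) * (2 * Real.exp (4 * d) * Real.exp 3 ^ d)) := by
        rw [ht]
        gcongr
        exact nine_le_exp_three
    _ = ENNReal.ofReal (2 * Real.exp (-(8 * d))) := by
        rw [← Real.exp_nat_mul, mul_assoc, ← Real.exp_add, mul_left_comm, ← Real.exp_add]
        ring_nf

lemma lintegral_entryLaw_exp_sum_sq_le (hd : d ≠ 0) :
    ∫⁻ g, ENNReal.ofReal (Real.exp (d / 8 * ∑ i, ∑ j, symMatrix g i j ^ 2)) ∂(entryLaw d) ≤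
      ENNReal.ofReal (Real.exp (d / 4 + 1 / 4)) := by
  have hcard : (Fintype.card (UpperPairs d) : ℝ) ≤ d ^ 2 := by exact_mod_cast card_upperPairs_le d
  let K : Matrix (UpperPairs d) (UpperPairs d) ℝ := (1 / (4 * d) : ℝ) • 1
  have hform (g : UpperPairs d → ℝ) :
      d / 8 * ∑ i, ∑ j, symMatrix g i j ^ 2 = (d : ℝ) ^ 2 * (g ⬝ᵥ K *ᵥ g) := by
    rw [sum_sq_symMatrix, smul_mulVec, one_mulVec, dotProduct_smul, smul_eq_mul, dotProduct]
    simp only [← sq]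
    field_simp
    ring
  have hsq : ∑ p, ∑ q, K p q ^ 2 ≤ 1 / 16 := by
    calc ∑ p, ∑ q, K p q ^ 2 = Fintype.card (UpperPairs d) * (1 / (4 * d) : ℝ) ^ 2 := by
          simp [K, Matrix.one_apply, ite_pow]
      _ ≤ d ^ 2 * (1 / (4 * d) : ℝ) ^ 2 := by gcongr
      _ = 1 / 16 := by
          field_simp
          norm_num
  have htrace : K.trace ≤ d / 4 := by
    calc K.trace = 1 / (4 * d) * Fintype.card (UpperPairs d) := by
          rw [trace_smul, trace_one, smul_eq_mul]
      _ ≤ 1 / (4 * d) * (d : ℝ) ^ 2 := by gcongr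
      _ = d / 4 := by field_simp
  simp_rw [hform]
  refine (lintegral_entryLaw_exp_quadraticForm_le hd
    (isHermitian_one.smul (IsSelfAdjoint.all _)) hsq).trans ?_
  exact ENNReal.ofReal_le_ofReal (Real.exp_le_exp.2 (by linarith))

lemma entryLaw_lt_frobeniusNorm_le (hd : d ≠ 0) {C : ℝ} (hC : 2 ≤ C) :
    entryLaw d {g | C < frobeniusNorm (symMatrix g)} ≤
      ENNReal.ofReal (Real.exp (1 / 4 - d / 4)) := by
  have hsub : {g : UpperPairs d → ℝ | C < frobeniusNorm (symMatrix g)} ⊆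
      {g | (d : ℝ) / 2 < d / 8 * ∑ i, ∑ j, symMatrix g i j ^ 2} := by
    intro g hg
    have hsq : C ^ 2 < ∑ i, ∑ j, symMatrix g i j ^ 2 := (Real.lt_sqrt (by linarith)).1 hg
    have : (0 : ℝ) < d := by positivity
    calc (d : ℝ) / 2 = d / 8 * 2 ^ 2 := by ring
      _ ≤ d / 8 * C ^ 2 := by gcongr
      _ < d / 8 * ∑ i, ∑ j, symMatrix g i j ^ 2 := by gcongr
  have hmeas : Measurable fun g : UpperPairs d → ℝ => d / 8 * ∑ i, ∑ j, symMatrix g i j ^ 2 := by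
    have := measurable_symMatrix_apply (d := d)
    fun_prop
  refine (measure_mono hsub).trans ((measure_lt_le_of_lintegral_exp_le hmeas
    (lintegral_entryLaw_exp_sum_sq_le hd) _).trans_eq ?_)
  rw [← Real.exp_add]
  ring_nf

lemma measurableSet_normEvent (C₁ C₂ : ℝ) : MeasurableSet (normEvent d C₁ C₂) := by
  have hfrobenius : Measurable fun g : UpperPairs d → ℝ => frobeniusNorm (symMatrix g) := by
    have := measurable_symMatrix_apply (d := d)
    unfold frobeniusNorm
    fun_prop
  exact (measurableSet_le continuous_l2_opNorm_symMatrix.measurable measurable_const).inter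
    (measurableSet_le hfrobenius measurable_const)

lemma compl_normEvent (C₁ C₂ : ℝ) : (normEvent d C₁ C₂)ᶜ =
    {g | C₁ / √(d : ℝ) < matSpectralNorm (symMatrix g)} ∪
      {g | C₂ < frobeniusNorm (symMatrix g)} := by
  ext g
  simp [normEvent, imp_iff_not_or]

lemma tendsto_entryLaw_normEvent {C₁ C₂ : ℝ} (h₁ : 64 ≤ C₁) (h₂ : 2 ≤ C₂) :
    Tendsto (fun d : ℕ => entryLaw d (normEvent d C₁ C₂)) atTop (𝓝 1) := by
  have hspectral : Tendsto (fun d : ℕ => 2 * Real.exp (-(8 * d))) atTop (𝓝 0) := by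
    simpa using (Real.tendsto_exp_neg_atTop_nhds_zero.comp
      (tendsto_natCast_atTop_atTop.const_mul_atTop (by norm_num : (0 : ℝ) < 8))).const_mul 2
  have hfrobenius : Tendsto (fun d : ℕ => Real.exp (1 / 4 - d / 4)) atTop (𝓝 0) :=
    Real.tendsto_exp_atBot.comp (tendsto_const_nhds.add_atBot (tendsto_neg_atTop_atBot.comp
      (tendsto_natCast_atTop_atTop.atTop_div_const (by norm_num : (0 : ℝ) < 4))))
  have hbound := (ENNReal.tendsto_ofReal hspectral).add (ENNReal.tendsto_ofReal hfrobenius)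
  have hcompl : Tendsto (fun d : ℕ => entryLaw d (normEvent d C₁ C₂)ᶜ) atTop (𝓝 0) := by
    refine tendsto_of_tendsto_of_tendsto_of_le_of_le' tendsto_const_nhds
      (by simpa only [ENNReal.ofReal_zero, add_zero] using hbound)
      (Eventually.of_forall fun _ => zero_le) ?_
    filter_upwards [eventually_ne_atTop 0] with d hd
    rw [compl_normEvent]
    exact (measure_union_le _ _).trans (add_le_add
      (entryLaw_lt_matSpectralNorm_le hd h₁) (entryLaw_lt_frobeniusNorm_le hd h₂))
  have hlim := ENNReal.Tendsto.sub (tendsto_const_nhds (x := (1 : ℝ≥0∞))) hcompl (by simp)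
  simpa only [← prob_compl_eq_one_sub (measurableSet_normEvent _ _).compl, compl_compl, tsub_zero]
    using hlim

end NormTails

section Ensemble

variable {κ : Type*} [Fintype κ] {w s : κ → ℝ} {d : ℕ} {C₁ C₂ : ℝ}

/-- The analogue of `ensembleSamples` for an arbitrary Gaussian scale mixture: draw `A` from its law
conditioned on `normEvent d C₁ C₂`, then `N` independent samples from `scaleMixture w s A`. -/
def mixtureEnsemble (w s : κ → ℝ) (d : ℕ) (C₁ C₂ : ℝ) (N : ℕ) :
    Measure (Fin N → EuclideanSpace ℝ (Fin d)) :=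
  ((entryLaw d)[|normEvent d C₁ C₂]).bind fun g => iidSamples N (scaleMixture w s (symMatrix g))

lemma noisyGaussian_eq_scaleMixture (A : Matrix (Fin d) (Fin d) ℝ) :
    noisyGaussian A = scaleMixture ![9 / 10, 1 / 10] ![1, -9] A := by
  have h₁ : ENNReal.ofReal (9 / 10) = 9 / 10 := by
    rw [ENNReal.ofReal_div_of_pos (by norm_num), ENNReal.ofReal_ofNat, ENNReal.ofReal_ofNat]
  have h₂ : ENNReal.ofReal (1 / 10) = 1 / 10 := by
    rw [ENNReal.ofReal_div_of_pos (by norm_num), ENNReal.ofReal_one, ENNReal.ofReal_ofNat]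
  simp only [noisyGaussian, scaleMixture, Fin.sum_univ_two, cons_val_zero, cons_val_one, h₁, h₂,
    one_smul, neg_smul, sub_eq_add_neg]

lemma ensembleSamples_eq_mixtureEnsemble (d : ℕ) (C₁ C₂ : ℝ) (N : ℕ) :
    ensembleSamples d C₁ C₂ N = mixtureEnsemble ![9 / 10, 1 / 10] ![1, -9] d C₁ C₂ N := by
  simp only [ensembleSamples, mixtureEnsemble, noisyGaussian_eq_scaleMixture]

lemma norm_smul_symMatrix_lt_one {r : ℝ} (hr : |r| * (C₁ / √d) < 1) {g : UpperPairs d → ℝ}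
    (hg : g ∈ normEvent d C₁ C₂) : ‖r • symMatrix g‖ < 1 := by
  rw [norm_smul, Real.norm_eq_abs]
  exact (mul_le_mul_of_nonneg_left hg.1 (abs_nonneg _)).trans_lt hr

instance isProbabilityMeasure_stdG : IsProbabilityMeasure (stdG d) := by
  unfold stdG
  infer_instance

lemma scaleMixture_ae_eq_withDensity (hs : ∀ k, |s k| * (C₁ / √d) < 1) (w : κ → ℝ) (C₂ : ℝ) :
    ∀ᵐ g ∂(entryLaw d)[|normEvent d C₁ C₂], scaleMixture w s (symMatrix g) =
      (stdG d).withDensity (mixtureDensity w s (symMatrix g)) := by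
  filter_upwards [ae_cond_mem (measurableSet_normEvent C₁ C₂)] with g hg
  rw [stdG, multivariateGaussian_zero_one, scaleMixture_eq_withDensity (isHermitian_symMatrix g)
    fun k => norm_smul_symMatrix_lt_one (hs k) hg]

lemma one_le_chiSq_mixtureEnsemble (hw : ∀ k, 0 ≤ w k) (hw1 : ∑ k, w k = 1)
    (hs : ∀ k, |s k| * (C₁ / √d) < 1) (hpos : entryLaw d (normEvent d C₁ C₂) ≠ 0) (N : ℕ) :
    1 ≤ chiSq (iidSamples N (stdG d)) (mixtureEnsemble w s d C₁ C₂ N)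
      (mixtureEnsemble w s d C₁ C₂ N) := by
  have := cond_isProbabilityMeasure hpos
  have := fun g : UpperPairs d → ℝ => isProbabilityMeasure_scaleMixture hw hw1 s (symMatrix g)
  exact one_le_chiSq_bind_iidSamples
    (measurable_uncurry_mixtureDensity w s measurable_symMatrix_apply)
    (scaleMixture_ae_eq_withDensity hs w C₂) N

lemma chiSq_mixtureEnsemble (hw : ∀ k, 0 ≤ w k) (hw1 : ∑ k, w k = 1)
    (hs : ∀ k, |s k| * (C₁ / √d) < 1) (hpos : entryLaw d (normEvent d C₁ C₂) ≠ 0) (N : ℕ) :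
    chiSq (iidSamples N (stdG d)) (mixtureEnsemble w s d C₁ C₂ N)
        (mixtureEnsemble w s d C₁ C₂ N) =
      ∫⁻ h, ∫⁻ g, ENNReal.ofReal (mixtureKernel w s (symMatrix g * symMatrix h)) ^ N
        ∂(entryLaw d)[|normEvent d C₁ C₂] ∂(entryLaw d)[|normEvent d C₁ C₂] := by
  have := cond_isProbabilityMeasure hpos
  have := fun g : UpperPairs d → ℝ => isProbabilityMeasure_scaleMixture hw hw1 s (symMatrix g)
  have hmem := ae_cond_mem (μ := entryLaw d) (measurableSet_normEvent (d := d) C₁ C₂)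
  unfold mixtureEnsemble
  rw [chiSq_bind_iidSamples (measurable_uncurry_mixtureDensity w s measurable_symMatrix_apply)
    (scaleMixture_ae_eq_withDensity hs w C₂)]
  refine lintegral_congr_ae ?_
  filter_upwards [hmem] with h hh
  refine lintegral_congr_ae ?_
  filter_upwards [hmem] with g hg
  rw [stdG, multivariateGaussian_zero_one, ← lintegral_mixtureDensity_mul hw
    (isHermitian_symMatrix g) (isHermitian_symMatrix h)
    (fun k => norm_smul_symMatrix_lt_one (hs k) hg) fun k => norm_smul_symMatrix_lt_one (hs k) hh]
  simp_rw [mul_comm (mixtureDensity w s (symMatrix g) _)]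

lemma ofReal_pow_le_exp_mul_exp (hd : d ≠ 0) {x y L ε : ℝ} (hx : x ≤ Real.exp (y + L / d ^ 2))
    {N : ℕ} (hN : N = ε * d ^ 2) :
    ENNReal.ofReal x ^ N ≤
      ENNReal.ofReal (Real.exp (ε * L)) * ENNReal.ofReal (Real.exp (ε * d ^ 2 * y)) := by
  calc ENNReal.ofReal x ^ N ≤ ENNReal.ofReal (Real.exp (y + L / d ^ 2)) ^ N := by gcongr
    _ = ENNReal.ofReal (Real.exp (ε * L + ε * d ^ 2 * y)) := by
        rw [← ENNReal.ofReal_pow (Real.exp_pos _).le, ← Real.exp_nat_mul, hN]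
        congr 2
        field_simp
        ring
    _ = _ := by rw [Real.exp_add, ENNReal.ofReal_mul (Real.exp_pos _).le]

lemma lintegral_cond_le {Ω : Type*} [MeasurableSpace Ω] (μ : Measure Ω) (t : Set Ω)
    (f : Ω → ℝ≥0∞) : ∫⁻ ω, f ω ∂μ[|t] ≤ (μ t)⁻¹ * ∫⁻ ω, f ω ∂μ := by
  rw [ProbabilityTheory.cond, lintegral_smul_measure, smul_eq_mul]
  gcongr
  exact Measure.restrict_le_self

lemma lintegral_cond_exp_traceForm_le {L c ε : ℝ} (hL : 0 ≤ L) (hc : 0 ≤ c) (hε : 0 ≤ ε)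
    (hd : d ≠ 0) {h : UpperPairs d → ℝ} (hh : h ∈ normEvent d C₁ C₂)
    (hsmall : ε ^ 2 * ((48 * L ^ 2 + 24 * c ^ 2) * (C₂ ^ 2) ^ 2) ≤ 1 / 16) :
    ∫⁻ g, ENNReal.ofReal (Real.exp (ε * d ^ 2 * (L * (symMatrix g * symMatrix h).trace ^ 2 +
        c * ((symMatrix g * symMatrix h) ^ 2).trace))) ∂(entryLaw d)[|normEvent d C₁ C₂] ≤
      (entryLaw d (normEvent d C₁ C₂))⁻¹ * ENNReal.ofReal (Real.exp
        (ε * ((4 * L + 2 * c) * C₂ ^ 2) +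
          4 * (ε ^ 2 * ((48 * L ^ 2 + 24 * c ^ 2) * (C₂ ^ 2) ^ 2)))) := by
  refine (lintegral_cond_le _ _ _).trans ?_
  gcongr
  exact lintegral_entryLaw_exp_traceForm_le hL hc hε hd (Real.sqrt_le_iff.1 hh.2).2 hsmall

lemma chiSq_mixtureEnsemble_le (hw : ∀ k, 0 ≤ w k) (hw1 : ∑ k, w k = 1)
    (hs : ∀ k, |s k| * (C₁ / √d) < 1) (hpos : entryLaw d (normEvent d C₁ C₂) ≠ 0) (hd : d ≠ 0)
    {L c ε : ℝ} (hL : 0 ≤ L) (hc : 0 ≤ c) (hkernel : ∀ A B : Matrix (Fin d) (Fin d) ℝ,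
      ‖A‖ ≤ C₁ / √d → ‖B‖ ≤ C₁ / √d → mixtureKernel w s (A * B) ≤
        Real.exp (L * (A * B).trace ^ 2 + c * ((A * B) ^ 2).trace + L / d ^ 2))
    {N : ℕ} (hN : N = ε * d ^ 2)
    (hsmall : ε ^ 2 * ((48 * L ^ 2 + 24 * c ^ 2) * (C₂ ^ 2) ^ 2) ≤ 1 / 16) :
    chiSq (iidSamples N (stdG d)) (mixtureEnsemble w s d C₁ C₂ N)
        (mixtureEnsemble w s d C₁ C₂ N) ≤
      (entryLaw d (normEvent d C₁ C₂))⁻¹ * ENNReal.ofReal (Real.exp (ε * L +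
        (ε * ((4 * L + 2 * c) * C₂ ^ 2) +
          4 * (ε ^ 2 * ((48 * L ^ 2 + 24 * c ^ 2) * (C₂ ^ 2) ^ 2))))) := by
  have hε : 0 ≤ ε := nonneg_of_mul_nonneg_left (hN ▸ N.cast_nonneg) (by positivity)
  let ν : Measure (UpperPairs d → ℝ) := (entryLaw d)[|normEvent d C₁ C₂]
  let Q (g h : UpperPairs d → ℝ) : ℝ :=
    L * (symMatrix g * symMatrix h).trace ^ 2 + c * ((symMatrix g * symMatrix h) ^ 2).trace
  let T : ℝ := (4 * L + 2 * c) * C₂ ^ 2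
  let R : ℝ := (48 * L ^ 2 + 24 * c ^ 2) * (C₂ ^ 2) ^ 2
  have : IsProbabilityMeasure ν := cond_isProbabilityMeasure hpos
  have hmem : ∀ᵐ g ∂ν, g ∈ normEvent d C₁ C₂ := ae_cond_mem (measurableSet_normEvent C₁ C₂)
  rw [chiSq_mixtureEnsemble hw hw1 hs hpos]
  calc ∫⁻ h, ∫⁻ g, ENNReal.ofReal (mixtureKernel w s (symMatrix g * symMatrix h)) ^ N ∂ν ∂ν
      ≤ ∫⁻ h, ∫⁻ g, ENNReal.ofReal (Real.exp (ε * L)) *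
          ENNReal.ofReal (Real.exp (ε * d ^ 2 * Q g h)) ∂ν ∂ν := by
        refine lintegral_mono_ae ?_
        filter_upwards [hmem] with h hh
        refine lintegral_mono_ae ?_
        filter_upwards [hmem] with g hg
          using ofReal_pow_le_exp_mul_exp hd (hkernel _ _ hg.1 hh.1) hN
    _ ≤ ∫⁻ _, ENNReal.ofReal (Real.exp (ε * L)) * ((entryLaw d (normEvent d C₁ C₂))⁻¹ *
          ENNReal.ofReal (Real.exp (ε * T + 4 * (ε ^ 2 * R)))) ∂ν := by
        refine lintegral_mono_ae ?_
        filter_upwards [hmem] with h hh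
        rw [lintegral_const_mul' _ _ ENNReal.ofReal_ne_top]
        gcongr
        exact lintegral_cond_exp_traceForm_le hL hc hε hd hh hsmall
    _ = _ := by
        rw [lintegral_const, measure_univ, mul_one, mul_left_comm,
          ← ENNReal.ofReal_mul (Real.exp_pos _).le, ← Real.exp_add]

lemma tendsto_chiSq_mixtureEnsemble (hw : ∀ k, 0 ≤ w k) (hw1 : ∑ k, w k = 1)
    (hws : ∑ k, w k * s k = 0)
    (hlim : Tendsto (fun d : ℕ => entryLaw d (normEvent d C₁ C₂)) atTop (𝓝 1)) {N : ℕ → ℕ}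
    (hN : (fun d : ℕ => (N d : ℝ)) =o[atTop] fun d : ℕ => (d : ℝ) ^ 2) :
    Tendsto (fun d : ℕ => chiSq (iidSamples (N d) (stdG d)) (mixtureEnsemble w s d C₁ C₂ (N d))
      (mixtureEnsemble w s d C₁ C₂ (N d))) atTop (𝓝 1) := by
  obtain ⟨L, hL, hkernel⟩ := exists_mixtureKernel_le hw hw1 hws C₁
  let ε (d : ℕ) : ℝ := N d / (d : ℝ) ^ 2
  let c : ℝ := (∑ k, w k * s k ^ 2) ^ 2 / 4
  let T : ℝ := (4 * L + 2 * c) * C₂ ^ 2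
  let R : ℝ := (48 * L ^ 2 + 24 * c ^ 2) * (C₂ ^ 2) ^ 2
  have hε : Tendsto ε atTop (𝓝 0) := hN.tendsto_div_nhds_zero
  have hεR : Tendsto (fun d => ε d ^ 2 * R) atTop (𝓝 0) := by
    simpa using (hε.pow 2).mul_const R
  have hexponent : Tendsto (fun d => ε d * L + (ε d * T + 4 * (ε d ^ 2 * R))) atTop (𝓝 0) := by
    simpa using (hε.mul_const L).add ((hε.mul_const T).add (hεR.const_mul 4))
  have hupper : Tendsto (fun d : ℕ => (entryLaw d (normEvent d C₁ C₂))⁻¹ *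
      ENNReal.ofReal (Real.exp (ε d * L + (ε d * T + 4 * (ε d ^ 2 * R))))) atTop (𝓝 1) := by
    simpa using ENNReal.Tendsto.mul (tendsto_inv_iff.2 hlim) (by simp)
      (ENNReal.tendsto_ofReal ((Real.continuous_exp.tendsto 0).comp hexponent)) (by simp)
  have hscale : ∀ᶠ d : ℕ in atTop, ∀ k, |s k| * (C₁ / √(d : ℝ)) < 1 := by
    have hradius : Tendsto (fun d : ℕ => C₁ / √(d : ℝ)) atTop (𝓝 0) :=
      tendsto_const_nhds.div_atTop (Real.tendsto_sqrt_atTop.comp tendsto_natCast_atTop_atTop)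
    exact eventually_all.2 fun k =>
      (hradius.const_mul |s k|).eventually_lt_const (by rw [mul_zero]; exact one_pos)
  have hpos := hlim.eventually_ne one_ne_zero
  refine tendsto_of_tendsto_of_tendsto_of_le_of_le' tendsto_const_nhds hupper ?_ ?_
  · filter_upwards [hscale, hpos] with d hs hpos
      using one_le_chiSq_mixtureEnsemble hw hw1 hs hpos (N d)
  · filter_upwards [hscale, hpos, hkernel, eventually_ne_atTop 0,
      hεR.eventually_le_const (by norm_num : (0 : ℝ) < 1 / 16)] with d hs hpos hkernel hd hsmall
    exact chiSq_mixtureEnsemble_le hw hw1 hs hpos hd hL (by positivity) hkernel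
      (div_mul_cancel₀ _ (by positivity)).symm hsmall

end Ensemble

end RobustCov

end

theorem mainTheorem2_general {κ : Type*} [Fintype κ] {w s : κ → ℝ} (hw : ∀ k, 0 ≤ w k)
    (hw1 : ∑ k, w k = 1) (hws : ∑ k, w k * s k = 0) :
    (∃ C₀ : ℝ, ∀ C₁ C₂ : ℝ, C₀ ≤ C₁ → C₀ ≤ C₂ →
      Tendsto (fun d : ℕ => RobustCov.entryLaw d (RobustCov.normEvent d C₁ C₂)) atTop (𝓝 1)) ∧
    (∀ C₁ C₂ : ℝ,
      Tendsto (fun d : ℕ => RobustCov.entryLaw d (RobustCov.normEvent d C₁ C₂)) atTop (𝓝 1) →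
      ∀ N : ℕ → ℕ, (fun d : ℕ => (N d : ℝ)) =o[atTop] (fun d : ℕ => (d : ℝ) ^ 2) →
        Tendsto (fun d : ℕ =>
          RobustCov.chiSq (RobustCov.iidSamples (N d) (RobustCov.stdG d))
            (RobustCov.mixtureEnsemble w s d C₁ C₂ (N d))
            (RobustCov.mixtureEnsemble w s d C₁ C₂ (N d))) atTop (𝓝 1)) :=
  ⟨⟨64, fun _ _ h₁ h₂ => RobustCov.tendsto_entryLaw_normEvent h₁ (by linarith)⟩,
    fun _ _ hlim _ hN => RobustCov.tendsto_chiSq_mixtureEnsemble hw hw1 hws hlim hN⟩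

theorem mainTheorem2 :
    (∃ C₀ : ℝ, ∀ C₁ C₂ : ℝ, C₀ ≤ C₁ → C₀ ≤ C₂ →
      Tendsto (fun d : ℕ => RobustCov.entryLaw d (RobustCov.normEvent d C₁ C₂)) atTop (𝓝 1)) ∧
    (∀ C₁ C₂ : ℝ,
      Tendsto (fun d : ℕ => RobustCov.entryLaw d (RobustCov.normEvent d C₁ C₂)) atTop (𝓝 1) →
      ∀ N : ℕ → ℕ, (fun d : ℕ => (N d : ℝ)) =o[atTop] (fun d : ℕ => (d : ℝ) ^ 2) →
        Tendsto (fun d : ℕ =>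
          RobustCov.chiSq (RobustCov.iidSamples (N d) (RobustCov.stdG d))
            (RobustCov.ensembleSamples d C₁ C₂ (N d))
            (RobustCov.ensembleSamples d C₁ C₂ (N d))) atTop (𝓝 1)) := by
  simpa only [RobustCov.ensembleSamples_eq_mixtureEnsemble] using mainTheorem2_general
    (w := ![9 / 10, 1 / 10]) (s := ![1, -9]) (by simp [Fin.forall_fin_two]; norm_num)
    (by simp [Fin.sum_univ_two]; norm_num) (by simp [Fin.sum_univ_two]; norm_num)
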